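/- Let $U$ be a finite set of alternatives with $|U|\ge 4$ and let $\Delta$ be the set of probability measures on $U$ (outcomes), with the topology of $\mathbb R^U$; identify $a\in U$ with the point mass at $a$ (a pure outcome). A preference relation is an asymmetric relation $\succ$ on $\Delta$; write $p\sim q$ if neither $p\succ q$ nor $q\succ p$, and $p\succsim q$ if $p\succ q$ or $p\sim q$. Let $\mathcal R$ be the set of preference relations that are - continuous: for every $p$, the sets $U(p)=\{q: q\succ p\}$ and $L(p)=\{q: p\succ q\}$ are open in $\Delta$; - convex: for every $p$, the sets $U(p)$, $L(p)$, $U(p)\cup I(p)$ and $L(p)\cup I(p)$ are convex, where $I(p)=\{q: p\sim q\}$; - symmetric: for all $p,q,r\in\Delta$ and $\lambda\in(0,1)$, if $q\sim \tfrac12p+\tfrac12r$ and $\lambda p+(1-\lambda)r\sim\tfrac12p+\tfrac12q$, then $\lambda r+(1-\lambda)p\sim\tfrac12r+\tfrac12q$. A set $\mathcal D\subseteq\mathcal R$ is a rich domain if 1. for every ${\succ}\in\mathcal R$, ${\succ}\in\mathcal D$ if and only if ${\succ}^\pi\in\mathcal D$ for every permutation $\pi$ of $U$, where $p^\pi\succ^\pi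 q^\pi$ if and only if $p\succ q$, and $p^\pi(\pi(a))=p(a)$; 2. the empty relation (complete indifference) is in $\mathcal D$; 3. the inverse of every relation in $\mathcal D$ is in $\mathcal D$; 4. for every ${\hat\succ}\in\mathcal D$ and every $X\subsetneq U$ with $|X|\le 4$ there are ${\succ}\in\mathcal D$ and $a\in U$ such that $\succ$ and $\hat\succ$ agree on the pure outcomes in $X$, and $x\succ a$ for all $x\in X$. Let $N=\{1,\dots,n\}$ with $n\ge2$. A social welfare function (SWF) on $\mathcal D$ is a function $f:\mathcal D^N\to\mathcal R$. It is anonymous if $f(R)=f(R\circ\pi)$ for all $R\in\mathcal D^N$ and all permutations $\pi$ of $N$. It is Pareto optimal if for all $R=(\succ_i)_{i\in N}\in\mathcal D^N$ with $f(R)={\succ}$ and all $p,q\in\Delta$: if $p\succsim_i q$ for all $i$, then $p\succsim q$, and if moreover $p\succ_i q$ for some $i$, then $p\succ q$. It satisfies independence of irrelevant alternatives (IIA) if for all $R,\hat R\in\mathcal D^N$ and $X\subseteq U$: if $R$ and $\hat R$ have the same restriction to the set $\Delta_X$ of outcomes supported in $X$ (agent by agent), then so do $f(R)$ and $f(\hat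 R)$. **Theorem.** Suppose that there is an anonymous SWF on a rich domain $\mathcal D$ that satisfies Pareto optimality and IIA. Then every ${\succ}\in\mathcal D$ is based on pairwise comparisons: there is a skew-symmetric bilinear (SSB) function $\phi:\Delta\times\Delta\to\mathbb R$ with $p\succ q\iff\phi(p,q)>0$ for all $p,q\in\Delta$, which is normalized (its largest value is $1$, or $\phi=0$ if $\succ$ is complete indifference), such that $\phi(a,b)\in\{-1,0,1\}$ for all $a,b\in U$. -/

import Mathlib

/-- Outcomes: probability measures on the finite set `U` of alternatives, with the topology
induced from `U → ℝ`. -/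
abbrev Lottery (U : Type*) [Fintype U] : Type _ := stdSimplex ℝ U

/-- Binary relations over outcomes; `P p q` reads "`p` is strictly preferred to `q`". -/
abbrev PrefRel (U : Type*) [Fintype U] : Type _ := Lottery U → Lottery U → Prop

namespace Lottery

variable {U : Type*} [Fintype U]

/-- The pure outcome that puts probability one on `a`. -/
noncomputable def pure [DecidableEq U] (a : U) : Lottery U :=
  ⟨Pi.single a 1, single_mem_stdSimplex ℝ a⟩

/-- The convex combination `t p + (1 - t) q`. -/
def mix (t : unitInterval) (p q : Lottery U) : Lottery U :=
  ⟨(t : ℝ) • (p : U → ℝ) + (1 - (t : ℝ)) • (q : U → ℝ),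
    convex_stdSimplex ℝ U p.2 q.2 t.2.1 (sub_nonneg.2 t.2.2) (add_sub_cancel _ _)⟩

/-- The equal mixture of two outcomes. -/
noncomputable def mid (p q : Lottery U) : Lottery U :=
  mix ⟨1 / 2, by norm_num, by norm_num⟩ p q

/-- The outcome with the alternatives renamed by `π`: its value at `π a` is `p a`. -/
def perm (π : Equiv.Perm U) (p : Lottery U) : Lottery U :=
  ⟨fun a => p (π.symm a), fun a => p.2.1 (π.symm a),
    (Equiv.sum_comp π.symm (fun a => p a)).trans p.2.2⟩

theorem perm_apply (π : Equiv.Perm U) (p : Lottery U) (a : U) : perm π p (π a) = p a := by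
  change p (π.symm (π a)) = p a
  rw [Equiv.symm_apply_apply]

theorem perm_symm_perm (π : Equiv.Perm U) (p : Lottery U) : perm π.symm (perm π p) = p :=
  stdSimplex.ext (funext fun a => perm_apply π p a)

/-- The outcomes whose support lies in `X`. -/
def supportedOn (X : Set U) : Set (Lottery U) := {p | ∀ a, a ∉ X → p a = 0}

end Lottery

namespace PrefRel

variable {U : Type*} [Fintype U]

/-- Indifference. -/
def Indiff (P : PrefRel U) (p q : Lottery U) : Prop := ¬ P p q ∧ ¬ P q p

/-- Weak preference. -/
def Weak (P : PrefRel U) (p q : Lottery U) : Prop := P p q ∨ P.Indiff p q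

/-- Strict upper contour set. -/
def upper (P : PrefRel U) (p : Lottery U) : Set (Lottery U) := {q | P q p}

/-- Strict lower contour set. -/
def lower (P : PrefRel U) (p : Lottery U) : Set (Lottery U) := {q | P p q}

/-- Indifference set. -/
def indiffSet (P : PrefRel U) (p : Lottery U) : Set (Lottery U) := {q | P.Indiff p q}

/-- Asymmetry: the requirement for being a (strict) preference relation. -/
def IsAsymm (P : PrefRel U) : Prop := ∀ p q, P p q → ¬ P q p

/-- Continuity; openness is relative to the simplex. -/
def IsContinuous (P : PrefRel U) : Prop := ∀ p, IsOpen (P.upper p) ∧ IsOpen (P.lower p)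

/-- Convexity of a set of outcomes, as a subset of `U → ℝ`. -/
def ConvexSet (S : Set (Lottery U)) : Prop := Convex ℝ ((fun p : Lottery U => (p : U → ℝ)) '' S)

/-- Convexity of a preference relation. -/
def IsConvex (P : PrefRel U) : Prop :=
  ∀ p, ConvexSet (P.upper p) ∧ ConvexSet (P.lower p) ∧
    ConvexSet (P.upper p ∪ P.indiffSet p) ∧ ConvexSet (P.lower p ∪ P.indiffSet p)

/-- Symmetry. -/
def IsSymmetric (P : PrefRel U) : Prop :=
  ∀ (p q r : Lottery U) (t : unitInterval), 0 < t → t < 1 →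
    P.Indiff q (Lottery.mid p r) →
    P.Indiff (Lottery.mix t p r) (Lottery.mid p q) →
    P.Indiff (Lottery.mix t r p) (Lottery.mid r q)

/-- Complete indifference: the empty relation. -/
def empty : PrefRel U := fun _ _ => False

/-- The inverse relation. -/
def inverse (P : PrefRel U) : PrefRel U := fun p q => P q p

/-- The relation with the alternatives renamed by `π`. -/
def perm (π : Equiv.Perm U) (P : PrefRel U) : PrefRel U :=
  fun p q => P (Lottery.perm π.symm p) (Lottery.perm π.symm q)

theorem perm_iff (π : Equiv.Perm U) (P : PrefRel U) (p q : Lottery U) :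
    P.perm π (Lottery.perm π p) (Lottery.perm π q) ↔ P p q := by
  simp only [perm, Lottery.perm_symm_perm]

/-- Two relations coincide on a set of outcomes. -/
def AgreeOn (S : Set (Lottery U)) (P Q : PrefRel U) : Prop :=
  ∀ p ∈ S, ∀ q ∈ S, (P p q ↔ Q p q)

end PrefRel

/-- The set of all continuous, convex and symmetric preference relations over outcomes. -/
def ccsPrefs (U : Type*) [Fintype U] : Set (PrefRel U) :=
  {P | P.IsAsymm ∧ P.IsContinuous ∧ P.IsConvex ∧ P.IsSymmetric}

section SSB

variable {U : Type*} [Fintype U]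

/-- Skew-symmetric bilinear functions on pairs of outcomes. -/
structure IsSSB (φ : Lottery U → Lottery U → ℝ) : Prop where
  skew : ∀ p q, φ p q = - φ q p
  linear_left : ∀ (t : unitInterval) (p q r : Lottery U),
    φ (Lottery.mix t p q) r = (t : ℝ) * φ p r + (1 - (t : ℝ)) * φ q r
  linear_right : ∀ (t : unitInterval) (p q r : Lottery U),
    φ p (Lottery.mix t q r) = (t : ℝ) * φ p q + (1 - (t : ℝ)) * φ p r

/-- `φ` represents `P`. -/
def Represents (φ : Lottery U → Lottery U → ℝ) (P : PrefRel U) : Prop :=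
  ∀ p q, P p q ↔ 0 < φ p q

/-- Normalization: the largest value is one, except for the zero function, which stands for
complete indifference. -/
def IsNormalized (φ : Lottery U → Lottery U → ℝ) : Prop :=
  (∀ p q, φ p q = 0) ∨ IsGreatest {x : ℝ | ∃ p q, φ p q = x} 1

/-- Normalized SSB functions based on pairwise comparisons. -/
def IsPCFunction [DecidableEq U] (φ : Lottery U → Lottery U → ℝ) : Prop :=
  IsSSB φ ∧ IsNormalized φ ∧
    ∀ a b : U, φ (Lottery.pure a) (Lottery.pure b) ∈ ({-1, 0, 1} : Set ℝ)

end SSB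

/-- The set of preference relations based on pairwise comparisons. -/
def pcPrefs (U : Type*) [Fintype U] [DecidableEq U] : Set (PrefRel U) :=
  {P | P ∈ ccsPrefs U ∧ ∃ φ : Lottery U → Lottery U → ℝ, IsPCFunction φ ∧ Represents φ P}

/-- Rich domains. -/
structure IsRichDomain {U : Type*} [Fintype U] [DecidableEq U] (D : Set (PrefRel U)) : Prop where
  subset_prefs : D ⊆ ccsPrefs U
  neutral : ∀ P ∈ ccsPrefs U, (P ∈ D ↔ ∀ π : Equiv.Perm U, P.perm π ∈ D)
  empty_mem : PrefRel.empty ∈ D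
  inverse_mem : ∀ P ∈ ccsPrefs U, P ∈ D → P.inverse ∈ D
  bottom : ∀ Q ∈ D, ∀ X : Finset U, X.card ≤ 4 → X ≠ Finset.univ →
    ∃ P ∈ D, ∃ a : U,
      P.AgreeOn (Lottery.pure '' (X : Set U)) Q ∧
      ∀ x ∈ X, P (Lottery.pure x) (Lottery.pure a)

section SWF

/-- Social welfare functions for the agents `Fin n` on the domain `D`. -/
abbrev SWF {U : Type*} [Fintype U] (n : ℕ) (D : Set (PrefRel U)) : Type _ :=
  (Fin n → D) → ccsPrefs U

variable {U : Type*} [Fintype U] {n : ℕ} {D : Set (PrefRel U)}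

/-- Pareto optimality: the weak part and the strict part. -/
def SWF.ParetoOptimal (f : SWF n D) : Prop :=
  ∀ (R : Fin n → D) (p q : Lottery U), (∀ i, (R i : PrefRel U).Weak p q) →
    (f R : PrefRel U).Weak p q ∧
      ((∃ i, (R i : PrefRel U) p q) → (f R : PrefRel U) p q)

/-- Independence of irrelevant alternatives. -/
def SWF.IIA (f : SWF n D) : Prop :=
  ∀ (R R' : Fin n → D) (X : Set U),
    (∀ i, PrefRel.AgreeOn (Lottery.supportedOn X) (R i : PrefRel U) (R' i : PrefRel U)) →
    PrefRel.AgreeOn (Lottery.supportedOn X) (f R : PrefRel U) (f R' : PrefRel U)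

/-- Anonymity. -/
def SWF.Anonymous (f : SWF n D) : Prop :=
  ∀ (R : Fin n → D) (π : Equiv.Perm (Fin n)), f R = f (R ∘ π)

end SWF

/-! The proof has two independent halves: a representation of single relations by skew-symmetric
bilinear forms, and an argument about the SWF showing that the nonzero entries of such a form share
one absolute value.

Representation. Symmetry makes indifference spread along segments (`IsCCSOn.indiff_extend`,
`IsCCSOn.strict_of_indiff`), so strict preference survives mixing with weakly preferred outcomes and
extends homogeneously to the nonnegative cone. At a positive vector, Hahn–Banach separates the
vectors above from those below by a linear functional, a gradient, unique up to a positive factor.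
Along a strictly ordered segment the gradients, normalized by their slope, are continuous, and
symmetry yields a midpoint identity that makes them affine in the parameter. Hence suitably scaled
gradients add (`IsGradient.add`). Comparing the two bracketings of a sum of three vectors makes the
scalings consistent (`gradient_cocycle`), and the gradients assemble into one skew form; a
perturbation covers the boundary.

Aggregation. Let all agents but two be completely indifferent. If these two disagree strictly about
two pure outcomes, society is indifferent: a verdict for one of them would spread through a third
alternative and contradict anonymity (`SWF.indiff_of_disagreement`). Now let `P` and `Q` agree on
the pure outcomes in `X`, and give one agent `P` and the other the inverse of `Q`. Society is
indifferent among the pure outcomes in `X`, hence by bilinearity among all outcomes supported on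
`X`, so Pareto optimality makes every indifference of `P` there an indifference of `Q`. Nested zero
sets make the forms proportional row by row. Applied to renamed and inverted copies of one relation,
and to copies with an added worst alternative, this equates the absolute values of all nonzero
entries (`IsSignDetermined.abs_eq`). -/

/-! ### Spreading of indifference on an interval -/

theorem doubling_of_interval_indifference {I : ℝ → ℝ → Prop}
    (hrefl : ∀ a ∈ Set.Icc (0 : ℝ) 1, I a a)
    (hcomm : ∀ a b, I a b → I b a)
    (hconv : ∀ a ∈ Set.Icc (0 : ℝ) 1, Set.OrdConnected {s | s ∈ Set.Icc (0 : ℝ) 1 ∧ I a s})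
    (hclosed : ∀ a ∈ Set.Icc (0 : ℝ) 1, IsClosed {s | s ∈ Set.Icc (0 : ℝ) 1 ∧ I a s})
    (hsymm : ∀ p ∈ Set.Icc (0 : ℝ) 1, ∀ q ∈ Set.Icc (0 : ℝ) 1, ∀ r ∈ Set.Icc (0 : ℝ) 1,
      ∀ t ∈ Set.Ioo (0 : ℝ) 1, I q ((p + r) / 2) → I (t * p + (1 - t) * r) ((p + q) / 2) →
        I (t * r + (1 - t) * p) ((r + q) / 2))
    {b r : ℝ} (hb : 0 < b) (hb1 : b ≤ 1) (hbr : b < r) (hrb : r ≤ 2 * b) (hr : r ≤ 1)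
    (h : I 0 b) : I 0 r := by
  have m0 : (0 : ℝ) ∈ Set.Icc (0 : ℝ) 1 := by simp
  have mr : r ∈ Set.Icc (0 : ℝ) 1 := ⟨by linarith, hr⟩
  have mr2 : r / 2 ∈ Set.Icc (0 : ℝ) 1 := ⟨by linarith, by linarith⟩
  have mb : b ∈ Set.Icc (0 : ℝ) 1 := ⟨hb.le, hb1⟩
  have ends : ∀ a ∈ Set.Icc (0 : ℝ) 1, (∀ s ∈ Set.Ioo 0 r, I a s) → I a 0 ∧ I a r := by
    intro a ha hs
    have hsub : Set.Icc 0 r ⊆ {s | s ∈ Set.Icc (0 : ℝ) 1 ∧ I a s} := by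
      rw [← closure_Ioo (by linarith : (0 : ℝ) ≠ r)]
      exact closure_minimal (fun s hs' => ⟨⟨hs'.1.le, by linarith [hs'.2]⟩, hs s hs'⟩)
        (hclosed a ha)
    exact ⟨(hsub ⟨le_rfl, by linarith⟩).2, (hsub ⟨by linarith, le_rfl⟩).2⟩
  have low : ∀ s ∈ Set.Icc 0 b, I 0 s := fun s hs =>
    ((hconv 0 m0).out ⟨m0, hrefl 0 m0⟩ ⟨mb, h⟩ hs).2
  -- Symmetry for the triple 0, 0, `r` applies because `r / 2 ≤ b`; it reflects the indifference of
  -- 0 and `s` to one of `r / 2` and `r - s`.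
  have refl1 : ∀ s, 0 < s → s ≤ b → I (r - s) (r / 2) := by
    intro s hs hsb
    have := hsymm 0 m0 0 m0 r mr (1 - s / r)
      ⟨by rw [sub_pos, div_lt_one (by linarith)]; linarith,
        by have : 0 < s / r := div_pos hs (by linarith)
           linarith⟩
      (low _ ⟨by linarith, by linarith⟩)
      (by
        have e : (1 - s / r) * 0 + (1 - (1 - s / r)) * r = s := by
          field_simp [(by linarith : r ≠ 0)]; ring
        rw [e]; simpa using hcomm _ _ (low s ⟨hs.le, hsb⟩))
    have e : (1 - s / r) * r + (1 - (1 - s / r)) * 0 = r - s := by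
      field_simp [(by linarith : r ≠ 0)]; ring
    rwa [e, add_zero] at this
  have h0 : I (r / 2) 0 := hcomm _ _ (low _ ⟨by linarith, by linarith⟩)
  -- The reflected points fill `[r - b, r)`; convexity joins them to 0.
  have all : ∀ s ∈ Set.Ioo 0 r, I (r / 2) s := by
    intro s hs
    by_cases hsb : r - b ≤ s
    · have := refl1 (r - s) (by linarith [hs.2]) (by linarith)
      rw [sub_sub_cancel] at this
      exact hcomm _ _ this
    · have m1 : r - b ∈ Set.Icc (0 : ℝ) 1 := ⟨by linarith, by linarith⟩
      exact ((hconv _ mr2).out ⟨m0, h0⟩ ⟨m1, hcomm _ _ (refl1 b hb le_rfl)⟩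
        ⟨hs.1.le, by linarith⟩).2
  have hr2 : I r (r / 2) := hcomm _ _ (ends _ mr2 all).2
  -- A second reflection, for the triple 0, `r`, `r`, turns indifference to `r / 2` into
  -- indifference to `r`.
  have all' : ∀ s ∈ Set.Ioo 0 r, I r s := by
    intro s hs
    have hs' : r - s ∈ Set.Ioo 0 r := ⟨by linarith [hs.2], by linarith [hs.1]⟩
    have := hsymm 0 m0 r mr r mr (s / r)
      ⟨div_pos hs.1 (by linarith), by rw [div_lt_one (by linarith)]; exact hs.2⟩
      (by simpa using hr2)
      (by
        have e : s / r * 0 + (1 - s / r) * r = r - s := by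
          field_simp [(by linarith : r ≠ 0)]; ring
        rw [e, zero_add]; exact hcomm _ _ (all _ hs'))
    have e : s / r * r + (1 - s / r) * 0 = s := by
      field_simp [(by linarith : r ≠ 0)]; ring
    rw [e, add_self_div_two] at this
    exact hcomm _ _ this
  exact hcomm _ _ (ends _ mr all').1

theorem interval_indifference {I : ℝ → ℝ → Prop}
    (hrefl : ∀ a ∈ Set.Icc (0 : ℝ) 1, I a a)
    (hcomm : ∀ a b, I a b → I b a)
    (hconv : ∀ a ∈ Set.Icc (0 : ℝ) 1, Set.OrdConnected {s | s ∈ Set.Icc (0 : ℝ) 1 ∧ I a s})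
    (hclosed : ∀ a ∈ Set.Icc (0 : ℝ) 1, IsClosed {s | s ∈ Set.Icc (0 : ℝ) 1 ∧ I a s})
    (hsymm : ∀ p ∈ Set.Icc (0 : ℝ) 1, ∀ q ∈ Set.Icc (0 : ℝ) 1, ∀ r ∈ Set.Icc (0 : ℝ) 1,
      ∀ t ∈ Set.Ioo (0 : ℝ) 1, I q ((p + r) / 2) → I (t * p + (1 - t) * r) ((p + q) / 2) →
        I (t * r + (1 - t) * p) ((r + q) / 2))
    {b : ℝ} (hb : 0 < b) (hb1 : b ≤ 1) (h : I 0 b) : I 0 1 := by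
  have key : ∀ n : ℕ, I 0 (min 1 (2 ^ n * b)) := by
    intro n
    induction n with
    | zero => simpa [hb1] using h
    | succ n ih =>
      set c := min 1 (2 ^ n * b) with hc
      have hc0 : 0 < c := lt_min one_pos (by positivity)
      have hc1 : c ≤ 1 := min_le_left _ _
      have e : min 1 (2 ^ (n + 1) * b) = min 1 (2 * c) := by
        rw [hc, pow_succ]
        rcases le_total 1 (2 ^ n * b) with h1 | h1
        · rw [min_eq_left h1, min_eq_left (by linarith), min_eq_left (by norm_num)]
        · rw [min_eq_right h1]; congr 1; ring
      rw [e]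
      rcases eq_or_lt_of_le (le_min hc1 (by linarith : c ≤ 2 * c)) with h1 | h1
      · rw [← h1]; exact ih
      · exact doubling_of_interval_indifference hrefl hcomm hconv hclosed hsymm hc0 hc1 h1
          (min_le_right _ _) (min_le_left _ _) ih
  obtain ⟨n, hn⟩ := pow_unbounded_of_one_lt (1 / b) (one_lt_two : (1 : ℝ) < 2)
  have h1 : 1 ≤ 2 ^ n * b := by
    rw [div_lt_iff₀ hb] at hn; exact hn.le
  have := key n
  rwa [min_eq_left h1] at this

/-! ### Continuous, convex and symmetric relations on a convex set -/

theorem midpoint_eq_half {E : Type*} [AddCommGroup E] [Module ℝ E] (x y : E) :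
    midpoint ℝ x y = (1 / 2 : ℝ) • x + (1 / 2 : ℝ) • y := by
  rw [midpoint_eq_smul_add, invOf_eq_inv, smul_add, one_div]

/-- Continuity, convexity and symmetry of an asymmetric relation on a closed convex set. -/
structure IsCCSOn {E : Type*} [AddCommGroup E] [Module ℝ E] [TopologicalSpace E] (S : Set E)
    (R : E → E → Prop) : Prop where
  asymm : ∀ p ∈ S, ∀ q ∈ S, R p q → ¬ R q p
  closed_left : ∀ p ∈ S, IsClosed {q | q ∈ S ∧ ¬ R q p}
  closed_right : ∀ p ∈ S, IsClosed {q | q ∈ S ∧ ¬ R p q}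
  convex_left : ∀ p ∈ S, Convex ℝ {q | q ∈ S ∧ R q p}
  convex_right : ∀ p ∈ S, Convex ℝ {q | q ∈ S ∧ R p q}
  convex_not_left : ∀ p ∈ S, Convex ℝ {q | q ∈ S ∧ ¬ R q p}
  convex_not_right : ∀ p ∈ S, Convex ℝ {q | q ∈ S ∧ ¬ R p q}
  symm : ∀ p ∈ S, ∀ q ∈ S, ∀ r ∈ S, ∀ t ∈ Set.Ioo (0 : ℝ) 1,
    (¬ R q (midpoint ℝ p r) ∧ ¬ R (midpoint ℝ p r) q) →
    (¬ R (t • p + (1 - t) • r) (midpoint ℝ p q) ∧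
      ¬ R (midpoint ℝ p q) (t • p + (1 - t) • r)) →
    (¬ R (t • r + (1 - t) • p) (midpoint ℝ r q) ∧
      ¬ R (midpoint ℝ r q) (t • r + (1 - t) • p))

namespace IsCCSOn

variable {E : Type*} [AddCommGroup E] [Module ℝ E] [TopologicalSpace E]
  {S : Set E} {R : E → E → Prop}

theorem swap (h : IsCCSOn S R) : IsCCSOn S (fun p q => R q p) where
  asymm p hp q hq := h.asymm q hq p hp
  closed_left := h.closed_right
  closed_right := h.closed_left
  convex_left := h.convex_right
  convex_right := h.convex_left
  convex_not_left := h.convex_not_right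
  convex_not_right := h.convex_not_left
  symm p hp q hq r hr t ht h1 h2 :=
    (h.symm p hp q hq r hr t ht h1.symm h2.symm).symm

theorem irrefl (h : IsCCSOn S R) {p : E} (hp : p ∈ S) : ¬ R p p :=
  fun hpp => h.asymm p hp p hp hpp hpp

theorem convex_indiff (h : IsCCSOn S R) {p : E} (hp : p ∈ S) :
    Convex ℝ {q | q ∈ S ∧ ¬ R p q ∧ ¬ R q p} := by
  have := (h.convex_not_left p hp).inter (h.convex_not_right p hp)
  convert this using 1
  ext q
  simp only [Set.mem_ofPred_eq, Set.mem_inter_iff]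
  tauto

theorem closed_indiff (h : IsCCSOn S R) {p : E} (hp : p ∈ S) :
    IsClosed {q | q ∈ S ∧ ¬ R p q ∧ ¬ R q p} := by
  have := (h.closed_left p hp).inter (h.closed_right p hp)
  convert this using 1
  ext q
  simp only [Set.mem_ofPred_eq, Set.mem_inter_iff]
  tauto

/-- Both `x` and `y` are indifferent to the point at `s`, so the convex indifference set of that
point contains the whole segment. -/
theorem indiff_segment (h : IsCCSOn S R) (hS : Convex ℝ S) {x y : E} (hx : x ∈ S) (hy : y ∈ S)
    (hI : ¬ R x y ∧ ¬ R y x) {s t : ℝ} (hs : s ∈ Set.Icc (0 : ℝ) 1) (ht : t ∈ Set.Icc (0 : ℝ) 1) :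
    ¬ R (AffineMap.lineMap x y s) (AffineMap.lineMap x y t) := by
  have ms := hS.lineMap_mem hx hy hs
  have hxs := ((h.convex_indiff hx).lineMap_mem ⟨hx, h.irrefl hx, h.irrefl hx⟩ ⟨hy, hI⟩ hs).2
  have hys := ((h.convex_indiff hy).lineMap_mem ⟨hx, hI.symm⟩ ⟨hy, h.irrefl hy, h.irrefl hy⟩ hs).2
  exact ((h.convex_indiff ms).lineMap_mem ⟨hx, hxs.symm⟩ ⟨hy, hys.symm⟩ ht).2.1

variable [IsTopologicalAddGroup E] [ContinuousSMul ℝ E]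

/-- Indifference between two points of a segment extends to the end of the segment. -/
theorem indiff_extend (h : IsCCSOn S R) (hS : Convex ℝ S) {x y : E} (hx : x ∈ S) (hy : y ∈ S)
    {b : ℝ} (hb : 0 < b) (hb1 : b ≤ 1)
    (hI : ¬ R x (AffineMap.lineMap x y b) ∧ ¬ R (AffineMap.lineMap x y b) x) :
    ¬ R x y ∧ ¬ R y x := by
  set l : ℝ → E := fun t => AffineMap.lineMap x y t with hl
  have hlS : ∀ t ∈ Set.Icc (0 : ℝ) 1, l t ∈ S := fun t ht => hS.lineMap_mem hx hy ht
  have hl0 : l 0 = x := AffineMap.lineMap_apply_zero _ _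
  have hl1 : l 1 = y := AffineMap.lineMap_apply_one _ _
  have hmid : ∀ s t, midpoint ℝ (l s) (l t) = l ((s + t) / 2) := by
    intro s t
    simp only [hl, AffineMap.lineMap_apply_module, midpoint_eq_half]
    module
  have hcomb : ∀ s t u : ℝ, u • l s + (1 - u) • l t = l (u * s + (1 - u) * t) := by
    intro s t u
    simp only [hl, AffineMap.lineMap_apply_module]
    module
  have hcont : Continuous l := AffineMap.lineMap_continuous
  have hset : ∀ a : ℝ, ∀ T : Set ℝ, T = l ⁻¹' {q | q ∈ S ∧ ¬ R (l a) q ∧ ¬ R q (l a)} →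
      Set.Icc (0 : ℝ) 1 ∩ T =
        {s | s ∈ Set.Icc (0 : ℝ) 1 ∧ (¬ R (l a) (l s) ∧ ¬ R (l s) (l a))} := by
    rintro a _ rfl
    ext s
    exact ⟨fun hs => ⟨hs.1, hs.2.2⟩, fun hs => ⟨hs.1, hlS s hs.1, hs.2⟩⟩
  have := interval_indifference (I := fun s t => ¬ R (l s) (l t) ∧ ¬ R (l t) (l s))
    (fun a ha => ⟨h.irrefl (hlS a ha), h.irrefl (hlS a ha)⟩)
    (fun a b hab => hab.symm)
    (fun a ha => by
      have h1 : Convex ℝ (AffineMap.lineMap x y ⁻¹'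
          {q | q ∈ S ∧ ¬ R (l a) q ∧ ¬ R q (l a)} : Set ℝ) :=
        (h.convex_indiff (hlS a ha)).affine_preimage (AffineMap.lineMap x y : ℝ →ᵃ[ℝ] E)
      have h2 := ((convex_Icc (0 : ℝ) 1).inter h1).ordConnected
      rw [hset a _ rfl] at h2
      exact h2)
    (fun a ha => by
      have h1 := (h.closed_indiff (hlS a ha)).preimage hcont
      have h2 := (isClosed_Icc (a := (0 : ℝ)) (b := 1)).inter h1
      rw [hset a _ rfl] at h2
      exact h2)
    (fun p hp q hq r hr t ht h1 h2 => by
      have := h.symm (l p) (hlS p hp) (l q) (hlS q hq) (l r) (hlS r hr) t ht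
      simp only [hmid, hcomb] at this
      exact this h1 h2)
    hb hb1 (by rw [hl0]; exact hI)
  simpa only [hl0, hl1] using this

/-- Strict preference between the ends of a segment orders the start strictly. -/
theorem strict_of_start (h : IsCCSOn S R) (hS : Convex ℝ S) {x y : E} (hx : x ∈ S) (hy : y ∈ S)
    (hR : R y x) {t : ℝ} (ht : 0 < t) (ht1 : t ≤ 1) : R (AffineMap.lineMap x y t) x := by
  by_contra hn
  have h1 : ¬ R x (AffineMap.lineMap x y t) :=
    ((h.convex_not_right x hx).lineMap_mem ⟨hx, h.irrefl hx⟩ ⟨hy, h.asymm y hy x hx hR⟩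
      ⟨ht.le, ht1⟩).2
  exact (h.indiff_extend hS hx hy ht ht1 ⟨h1, hn⟩).2 hR

/-- Carries indifference to `x` past the midpoint of `p` and `r`. Symmetry is applied with `q`
halfway between `x` and that midpoint. The weight 5/6 puts `x`, the midpoint of `p` and `q`, and the
mixture of `p` and `r` on one line; the mirrored mixture is then indifferent to a point of its
segment to `x`, and `indiff_extend` reaches `x`. -/
theorem indiff_tilt (h : IsCCSOn S R) (hS : Convex ℝ S) {x p r : E} (hx : x ∈ S) (hp : p ∈ S)
    (hr : r ∈ S) (hxp : ¬ R x p ∧ ¬ R p x)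
    (hxm : ¬ R x (midpoint ℝ p r) ∧ ¬ R (midpoint ℝ p r) x) :
    ¬ R x ((5 / 6 : ℝ) • r + (1 / 6 : ℝ) • p) ∧ ¬ R ((5 / 6 : ℝ) • r + (1 / 6 : ℝ) • p) x := by
  have hm : midpoint ℝ p r ∈ S := hS.midpoint_mem hp hr
  have hq : midpoint ℝ x (midpoint ℝ p r) ∈ S := hS.midpoint_mem hx hm
  have hs : (5 / 6 : ℝ) • p + (1 / 6 : ℝ) • r ∈ S := hS hp hr (by norm_num) (by norm_num)
    (by norm_num)
  have hu : (5 / 6 : ℝ) • r + (1 / 6 : ℝ) • p ∈ S := hS hr hp (by norm_num) (by norm_num)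
    (by norm_num)
  have hxs : ¬ R x ((5 / 6 : ℝ) • p + (1 / 6 : ℝ) • r) ∧
      ¬ R ((5 / 6 : ℝ) • p + (1 / 6 : ℝ) • r) x := by
    have := h.convex_indiff hx ⟨hp, hxp⟩ ⟨hm, hxm⟩ (by norm_num : (0 : ℝ) ≤ 2 / 3)
      (by norm_num : (0 : ℝ) ≤ 1 / 3) (by norm_num)
    have e : (2 / 3 : ℝ) • p + (1 / 3 : ℝ) • midpoint ℝ p r =
        (5 / 6 : ℝ) • p + (1 / 6 : ℝ) • r := by
      rw [midpoint_eq_half]; module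
    rw [e] at this
    exact this.2
  have e1 : midpoint ℝ x (midpoint ℝ p r) =
      AffineMap.lineMap x (midpoint ℝ p r) (1 / 2 : ℝ) := by
    simp only [AffineMap.lineMap_apply_module, midpoint_eq_half]; module
  have e2 : midpoint ℝ p (midpoint ℝ x (midpoint ℝ p r)) =
      AffineMap.lineMap x ((5 / 6 : ℝ) • p + (1 / 6 : ℝ) • r) (3 / 4 : ℝ) := by
    simp only [AffineMap.lineMap_apply_module, midpoint_eq_half]; module
  have e3 : midpoint ℝ r (midpoint ℝ x (midpoint ℝ p r)) =
      AffineMap.lineMap x ((5 / 6 : ℝ) • r + (1 / 6 : ℝ) • p) (3 / 4 : ℝ) := by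
    simp only [AffineMap.lineMap_apply_module, midpoint_eq_half]; module
  have m1 : (1 : ℝ) ∈ Set.Icc (0 : ℝ) 1 := by simp
  have mh : (1 / 2 : ℝ) ∈ Set.Icc (0 : ℝ) 1 := by constructor <;> norm_num
  have mq : (3 / 4 : ℝ) ∈ Set.Icc (0 : ℝ) 1 := by constructor <;> norm_num
  have key := h.symm p hp _ hq r hr (5 / 6) ⟨by norm_num, by norm_num⟩
    (by
      have a := h.indiff_segment hS hx hm hxm mh m1
      have b := h.indiff_segment hS hx hm hxm m1 mh
      rw [AffineMap.lineMap_apply_one] at a b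
      rw [e1]; exact ⟨a, b⟩)
    (by
      have a := h.indiff_segment hS hx hs hxs mq m1
      have b := h.indiff_segment hS hx hs hxs m1 mq
      rw [AffineMap.lineMap_apply_one] at a b
      rw [e2, (by norm_num : (1 - 5 / 6 : ℝ) = 1 / 6)]; exact ⟨b, a⟩)
  rw [e3, (by norm_num : (1 - 5 / 6 : ℝ) = 1 / 6)] at key
  have := h.indiff_extend hS hu hx (b := 1 / 4) (by norm_num) (by norm_num)
    (by
      have e : AffineMap.lineMap ((5 / 6 : ℝ) • r + (1 / 6 : ℝ) • p) x (1 / 4 : ℝ) =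
          AffineMap.lineMap x ((5 / 6 : ℝ) • r + (1 / 6 : ℝ) • p) (3 / 4 : ℝ) := by
        simp only [AffineMap.lineMap_apply_module]; module
      rw [e]; exact key)
  exact this.symm

/-- A mixture of a strictly better point and an indifferent point is strictly better. -/
theorem strict_of_indiff (h : IsCCSOn S R) (hS : Convex ℝ S) {x q r : E} (hx : x ∈ S)
    (hq : q ∈ S) (hr : r ∈ S) (hqx : R q x) (hrx : ¬ R x r ∧ ¬ R r x) {t : ℝ} (ht : 0 < t)
    (ht1 : t ≤ 1) : R (AffineMap.lineMap r q t) x := by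
  by_contra hn
  set l : ℝ → E := fun t => AffineMap.lineMap r q t with hl
  have hlS : ∀ t ∈ Set.Icc (0 : ℝ) 1, l t ∈ S := fun t ht => hS.lineMap_mem hr hq ht
  have hcont : Continuous l := AffineMap.lineMap_continuous
  set Z : Set ℝ := Set.Icc (0 : ℝ) 1 ∩ l ⁻¹' {q | q ∈ S ∧ ¬ R x q ∧ ¬ R q x} with hZ
  have hZc : IsCompact Z := isCompact_Icc.inter_right ((h.closed_indiff hx).preimage hcont)
  have htn : ¬ R x (l t) :=
    ((h.convex_not_right x hx).lineMap_mem ⟨hr, hrx.1⟩ ⟨hq, h.asymm q hq x hx hqx⟩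
      ⟨ht.le, ht1⟩).2
  have htZ : t ∈ Z := ⟨⟨ht.le, ht1⟩, hlS t ⟨ht.le, ht1⟩, htn, hn⟩
  -- The last point of the segment indifferent to `x`; the tilt will produce a later one.
  obtain ⟨b, hbZ, hbmax⟩ := hZc.exists_isGreatest ⟨t, htZ⟩
  have hb0 : 0 < b := ht.trans_le (hbmax htZ)
  have hb1 : b < 1 := by
    refine lt_of_le_of_ne hbZ.1.2 ?_
    rintro rfl
    apply hbZ.2.2.2
    simpa [hl] using hqx
  have hdown : ∀ s ∈ Set.Icc 0 b, ¬ R x (l s) ∧ ¬ R (l s) x := by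
    intro s hs
    have h1 : Convex ℝ (AffineMap.lineMap r q ⁻¹' {q | q ∈ S ∧ ¬ R x q ∧ ¬ R q x} : Set ℝ) :=
      (h.convex_indiff hx).affine_preimage (AffineMap.lineMap r q : ℝ →ᵃ[ℝ] E)
    have h0 : (0 : ℝ) ∈ (AffineMap.lineMap r q ⁻¹' {q | q ∈ S ∧ ¬ R x q ∧ ¬ R q x} : Set ℝ) := by
      rw [Set.mem_preimage, AffineMap.lineMap_apply_zero]
      exact ⟨hr, hrx⟩
    exact (h1.ordConnected.out h0 hbZ.2 hs).2
  -- The points at `b - 2 * d` and `b + d` stay in the segment. Their midpoint, at `b - d / 2`, is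
  -- still indifferent to `x`, while their 5/6 mixture lies at `b + d / 2`.
  set d : ℝ := min (b / 2) (1 - b) with hd
  have hd0 : 0 < d := lt_min (by linarith) (by linarith)
  have hdb : d ≤ b / 2 := min_le_left _ _
  have hdb1 : d ≤ 1 - b := min_le_right _ _
  have hm : midpoint ℝ (l (b - 2 * d)) (l (b + d)) = l (b - d / 2) := by
    simp only [hl, AffineMap.lineMap_apply_module, midpoint_eq_half]
    module
  have he : (5 / 6 : ℝ) • l (b + d) + (1 / 6 : ℝ) • l (b - 2 * d) = l (b + d / 2) := by
    simp only [hl, AffineMap.lineMap_apply_module]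
    module
  have key := h.indiff_tilt hS hx (hlS (b - 2 * d) ⟨by linarith, by linarith⟩)
    (hlS (b + d) ⟨by linarith, by linarith⟩)
    (hdown _ ⟨by linarith, by linarith⟩)
    (by rw [hm]; exact hdown _ ⟨by linarith, by linarith⟩)
  rw [he] at key
  have : b + d / 2 ∈ Z :=
    ⟨⟨by linarith, by linarith⟩, hlS _ ⟨by linarith, by linarith⟩, key⟩
  linarith [hbmax this]

/-- A mixture of a strictly better point and a weakly better point is strictly better. -/
theorem strict_combination (h : IsCCSOn S R) (hS : Convex ℝ S) {x q r : E} (hx : x ∈ S)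
    (hq : q ∈ S) (hr : r ∈ S) (hqx : R q x) (hrx : ¬ R x r) {s t : ℝ} (hs : 0 < s)
    (ht : 0 ≤ t) (hst : s + t = 1) : R (s • q + t • r) x := by
  by_cases h1 : R r x
  · exact (h.convex_left x hx ⟨hq, hqx⟩ ⟨hr, h1⟩ hs.le ht hst).2
  · have := h.strict_of_indiff hS hx hq hr hqx ⟨hrx, h1⟩ hs (by linarith)
    rwa [AffineMap.lineMap_apply_module, ← hst, add_sub_cancel_left, add_comm] at this

end IsCCSOn

/-! ### Homogeneous extension to the nonnegative cone -/

section ConeRelation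

variable {U : Type*} [Fintype U]

/-- The nonzero vectors with nonnegative coordinates. -/
def nonnegCone (U : Type*) [Fintype U] : Set (U → ℝ) := {x | (∀ a, 0 ≤ x a) ∧ 0 < ∑ a, x a}

/-- The vectors with positive coordinates. -/
def posCone (U : Type*) : Set (U → ℝ) := {x | ∀ a, 0 < x a}

theorem posCone_subset [Nonempty U] : posCone U ⊆ nonnegCone U := fun _ hx =>
  ⟨fun a => (hx a).le, Finset.sum_pos (fun a _ => hx a) Finset.univ_nonempty⟩

theorem isOpen_posCone : IsOpen (posCone U) := by
  have : posCone U = ⋂ a, {x : U → ℝ | 0 < x a} := by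
    ext x; simp [posCone]
  rw [this]
  exact isOpen_iInter_of_finite fun a => isOpen_lt continuous_const (continuous_apply a)

theorem nonnegCone_add {x y : U → ℝ} (hx : x ∈ nonnegCone U) (hy : y ∈ nonnegCone U) :
    x + y ∈ nonnegCone U :=
  ⟨fun a => add_nonneg (hx.1 a) (hy.1 a), by
    simpa [Finset.sum_add_distrib] using add_pos hx.2 hy.2⟩

omit [Fintype U] in
theorem posCone_add_nonneg {x y : U → ℝ} (hx : x ∈ posCone U) (hy : ∀ a, 0 ≤ y a) :
    x + y ∈ posCone U := fun a => add_pos_of_pos_of_nonneg (hx a) (hy a)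

omit [Fintype U] in
theorem posCone_add {x y : U → ℝ} (hx : x ∈ posCone U) (hy : y ∈ posCone U) :
    x + y ∈ posCone U := fun a => add_pos (hx a) (hy a)

omit [Fintype U] in
theorem posCone_smul {x : U → ℝ} (hx : x ∈ posCone U) {s : ℝ} (hs : 0 < s) :
    s • x ∈ posCone U := fun a => mul_pos hs (hx a)

theorem stdSimplex_subset_nonnegCone : stdSimplex ℝ U ⊆ nonnegCone U :=
  fun _ hx => ⟨hx.1, by rw [hx.2]; exact one_pos⟩

/-- A relation on rays of the nonnegative cone, with the properties that a continuous, convex and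
symmetric relation on the simplex induces there. -/
structure IsConeRel (R : (U → ℝ) → (U → ℝ) → Prop) : Prop where
  asymm : ∀ x ∈ nonnegCone U, ∀ y ∈ nonnegCone U, R x y → ¬ R y x
  smul_left : ∀ x y, ∀ s : ℝ, 0 < s → (R (s • x) y ↔ R x y)
  smul_right : ∀ x y, ∀ s : ℝ, 0 < s → (R x (s • y) ↔ R x y)
  add_left : ∀ x ∈ nonnegCone U, ∀ y ∈ nonnegCone U, ∀ p ∈ nonnegCone U,
    R x p → ¬ R p y → R (x + y) p
  add_right : ∀ x ∈ nonnegCone U, ∀ y ∈ nonnegCone U, ∀ p ∈ nonnegCone U,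
    R p x → ¬ R y p → R p (x + y)
  not_add_left : ∀ x ∈ nonnegCone U, ∀ y ∈ nonnegCone U, ∀ p ∈ nonnegCone U,
    ¬ R x p → ¬ R y p → ¬ R (x + y) p
  not_add_right : ∀ x ∈ nonnegCone U, ∀ y ∈ nonnegCone U, ∀ p ∈ nonnegCone U,
    ¬ R p x → ¬ R p y → ¬ R p (x + y)
  eventually_left : ∀ x ∈ nonnegCone U, ∀ p ∈ nonnegCone U, R x p →
    ∀ᶠ y in nhdsWithin x (nonnegCone U), R y p
  eventually_right : ∀ x ∈ nonnegCone U, ∀ p ∈ nonnegCone U, R p x →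
    ∀ᶠ y in nhdsWithin x (nonnegCone U), R p y
  symm : ∀ p ∈ stdSimplex ℝ U, ∀ q ∈ stdSimplex ℝ U, ∀ r ∈ stdSimplex ℝ U,
    ∀ t ∈ Set.Ioo (0 : ℝ) 1,
    (¬ R q (p + r) ∧ ¬ R (p + r) q) →
    (¬ R (t • p + (1 - t) • r) (p + q) ∧ ¬ R (p + q) (t • p + (1 - t) • r)) →
    (¬ R (t • r + (1 - t) • p) (r + q) ∧ ¬ R (r + q) (t • r + (1 - t) • p))

theorem IsConeRel.swap {R : (U → ℝ) → (U → ℝ) → Prop} (h : IsConeRel R) :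
    IsConeRel (fun x y => R y x) where
  asymm x hx y hy := h.asymm y hy x hx
  smul_left x y := h.smul_right y x
  smul_right x y := h.smul_left y x
  add_left := h.add_right
  add_right := h.add_left
  not_add_left := h.not_add_right
  not_add_right := h.not_add_left
  eventually_left := h.eventually_right
  eventually_right := h.eventually_left
  symm p hp q hq r hr t ht h1 h2 := (h.symm p hp q hq r hr t ht h1.symm h2.symm).symm

/-- The multiple of a vector with coordinates that sum to one. -/
noncomputable def normalizeSum (x : U → ℝ) : U → ℝ := (∑ a, x a)⁻¹ • x

theorem normalizeSum_mem {x : U → ℝ} (hx : x ∈ nonnegCone U) :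
    normalizeSum x ∈ stdSimplex ℝ U :=
  ⟨fun a => mul_nonneg (inv_nonneg.2 hx.2.le) (hx.1 a), by
    simp only [normalizeSum, Pi.smul_apply, smul_eq_mul, ← Finset.mul_sum]
    exact inv_mul_cancel₀ hx.2.ne'⟩

theorem normalizeSum_smul (x : U → ℝ) {s : ℝ} (hs : 0 < s) :
    normalizeSum (s • x) = normalizeSum x := by
  simp only [normalizeSum, Pi.smul_apply, smul_eq_mul, ← Finset.mul_sum, mul_inv, smul_smul]
  congr 1
  field_simp

theorem normalizeSum_of_mem {x : U → ℝ} (hx : x ∈ stdSimplex ℝ U) : normalizeSum x = x := by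
  simp [normalizeSum, hx.2]

theorem normalizeSum_add {x y : U → ℝ} (hx : x ∈ nonnegCone U) (hy : y ∈ nonnegCone U) :
    ∃ s t : ℝ, 0 < s ∧ 0 < t ∧ s + t = 1 ∧
      normalizeSum (x + y) = s • normalizeSum x + t • normalizeSum y := by
  have hxp := hx.2
  have hyp := hy.2
  refine ⟨(∑ a, x a) / (∑ a, x a + ∑ a, y a), (∑ a, y a) / (∑ a, x a + ∑ a, y a),
    by positivity, by positivity, by field_simp, ?_⟩
  simp only [normalizeSum, Pi.add_apply, Finset.sum_add_distrib, smul_add, smul_smul]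
  congr 2 <;> field_simp

theorem normalizeSum_add_of_mem {x y : U → ℝ} (hx : x ∈ stdSimplex ℝ U)
    (hy : y ∈ stdSimplex ℝ U) : normalizeSum (x + y) = midpoint ℝ x y := by
  rw [midpoint_eq_half, normalizeSum]
  simp only [Pi.add_apply, Finset.sum_add_distrib, hx.2, hy.2, smul_add]
  norm_num

/-- Normalization turns a sum into a mixture with positive weights, and a sum of two outcomes into
their midpoint. The right-hand properties follow from the left-hand ones for the converse relation.
-/
theorem IsCCSOn.isConeRel {R : (U → ℝ) → (U → ℝ) → Prop} (h : IsCCSOn (stdSimplex ℝ U) R) :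
    IsConeRel (fun x y => R (normalizeSum x) (normalizeSum y)) := by
  have half : ∀ {R : (U → ℝ) → (U → ℝ) → Prop}, IsCCSOn (stdSimplex ℝ U) R →
      (∀ x ∈ nonnegCone U, ∀ y ∈ nonnegCone U, ∀ p ∈ nonnegCone U,
        R (normalizeSum x) (normalizeSum p) → ¬ R (normalizeSum p) (normalizeSum y) →
          R (normalizeSum (x + y)) (normalizeSum p)) ∧
      (∀ x ∈ nonnegCone U, ∀ y ∈ nonnegCone U, ∀ p ∈ nonnegCone U,
        ¬ R (normalizeSum x) (normalizeSum p) → ¬ R (normalizeSum y) (normalizeSum p) →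
          ¬ R (normalizeSum (x + y)) (normalizeSum p)) ∧
      (∀ x ∈ nonnegCone U, ∀ p ∈ nonnegCone U, R (normalizeSum x) (normalizeSum p) →
        ∀ᶠ y in nhdsWithin x (nonnegCone U), R (normalizeSum y) (normalizeSum p)) := by
    intro R h
    refine ⟨fun x hx y hy p hp h1 h2 => ?_, fun x hx y hy p hp h1 h2 => ?_,
      fun x hx p hp h1 => ?_⟩
    · obtain ⟨s, t, hs, ht, hst, e⟩ := normalizeSum_add hx hy
      rw [e]
      exact h.strict_combination (convex_stdSimplex ℝ U) (normalizeSum_mem hp)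
        (normalizeSum_mem hx) (normalizeSum_mem hy) h1 h2 hs ht.le hst
    · obtain ⟨s, t, hs, ht, hst, e⟩ := normalizeSum_add hx hy
      rw [e]
      exact (h.convex_not_left _ (normalizeSum_mem hp) ⟨normalizeSum_mem hx, h1⟩
        ⟨normalizeSum_mem hy, h2⟩ hs.le ht.le hst).2
    · have hc : ContinuousAt (normalizeSum : (U → ℝ) → (U → ℝ)) x := by
        unfold normalizeSum
        refine ContinuousAt.smul (ContinuousAt.inv₀ ?_ hx.2.ne') continuousAt_id
        fun_prop
      have hop := (h.closed_left _ (normalizeSum_mem hp)).isOpen_compl.mem_nhds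
        (show normalizeSum x ∉ _ from fun hm => hm.2 h1)
      have h2 := (hc.eventually hop).filter_mono (nhdsWithin_le_nhds (s := nonnegCone U))
      filter_upwards [h2, self_mem_nhdsWithin] with y hy hyC
      by_contra hn
      exact hy ⟨normalizeSum_mem hyC, hn⟩
  refine
    { asymm := fun x hx y hy => h.asymm _ (normalizeSum_mem hx) _ (normalizeSum_mem hy)
      smul_left := fun x y s hs => by rw [normalizeSum_smul x hs]
      smul_right := fun x y s hs => by rw [normalizeSum_smul y hs]
      add_left := (half h).1
      add_right := (half h.swap).1
      not_add_left := (half h).2.1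
      not_add_right := (half h.swap).2.1
      eventually_left := (half h).2.2
      eventually_right := (half h.swap).2.2
      symm := ?_ }
  intro p hp q hq r hr t ht
  have m1 : t • p + (1 - t) • r ∈ stdSimplex ℝ U :=
    convex_stdSimplex ℝ U hp hr ht.1.le (by linarith [ht.2]) (by ring)
  have m2 : t • r + (1 - t) • p ∈ stdSimplex ℝ U :=
    convex_stdSimplex ℝ U hr hp ht.1.le (by linarith [ht.2]) (by ring)
  rw [normalizeSum_add_of_mem hp hr, normalizeSum_add_of_mem hp hq, normalizeSum_add_of_mem hr hq,
    normalizeSum_of_mem m1, normalizeSum_of_mem m2, normalizeSum_of_mem hq]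
  exact h.symm p hp q hq r hr t ht

end ConeRelation

/-! ### Transfer of preference relations to vectors -/

namespace PrefRel

variable {U : Type*} [Fintype U]

/-- A relation over outcomes as a relation on the ambient vector space. -/
def onVectors (P : PrefRel U) (x y : U → ℝ) : Prop :=
  ∃ (hx : x ∈ stdSimplex ℝ U) (hy : y ∈ stdSimplex ℝ U), P ⟨x, hx⟩ ⟨y, hy⟩

theorem onVectors_iff (P : PrefRel U) {x y : U → ℝ} (hx : x ∈ stdSimplex ℝ U)
    (hy : y ∈ stdSimplex ℝ U) : P.onVectors x y ↔ P ⟨x, hx⟩ ⟨y, hy⟩ :=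
  ⟨fun ⟨_, _, h⟩ => h, fun h => ⟨hx, hy, h⟩⟩

theorem isCCSOn_onVectors {P : PrefRel U} (h : P ∈ ccsPrefs U) :
    IsCCSOn (stdSimplex ℝ U) P.onVectors := by
  obtain ⟨ha, hc, hv, hs⟩ := h
  have closed : ∀ (V : Set (Lottery U)), IsOpen V →
      IsClosed {q : U → ℝ | q ∈ stdSimplex ℝ U ∧ ∀ hq : q ∈ stdSimplex ℝ U, ⟨q, hq⟩ ∉ V} := by
    intro V hV
    have := (isClosed_stdSimplex ℝ U).isClosedEmbedding_subtypeVal.isClosedMap _ hV.isClosed_compl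
    convert this using 1
    ext q
    constructor
    · rintro ⟨hq, h⟩; exact ⟨⟨q, hq⟩, h hq, rfl⟩
    · rintro ⟨q, h, rfl⟩; exact ⟨q.2, fun _ => h⟩
  have conv : ∀ (V : Set (Lottery U)) (W : Set (U → ℝ)), PrefRel.ConvexSet V →
      (∀ q : Lottery U, (q : U → ℝ) ∈ W ↔ q ∈ V) → Convex ℝ {q | q ∈ stdSimplex ℝ U ∧ q ∈ W} := by
    intro V W hV hW
    have e : {q | q ∈ stdSimplex ℝ U ∧ q ∈ W} = (fun p : Lottery U => (p : U → ℝ)) '' V := by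
      ext q
      exact ⟨fun ⟨hq, h⟩ => ⟨⟨q, hq⟩, (hW ⟨q, hq⟩).1 h, rfl⟩,
        fun ⟨q', h, e⟩ => e ▸ ⟨q'.2, (hW q').2 h⟩⟩
    rw [e]
    exact hV
  refine ⟨?_, ?_, ?_, ?_, ?_, ?_, ?_, ?_⟩
  · rintro p hp q hq ⟨_, _, h1⟩ ⟨_, _, h2⟩
    exact ha _ _ h1 h2
  · intro p hp
    convert closed _ (hc ⟨p, hp⟩).1 using 1
    ext q
    exact ⟨fun h => ⟨h.1, fun hq hm => h.2 ⟨hq, hp, hm⟩⟩,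
      fun h => ⟨h.1, fun ⟨hq, _, hm⟩ => h.2 hq hm⟩⟩
  · intro p hp
    convert closed _ (hc ⟨p, hp⟩).2 using 1
    ext q
    exact ⟨fun h => ⟨h.1, fun hq hm => h.2 ⟨hp, hq, hm⟩⟩,
      fun h => ⟨h.1, fun ⟨_, hq, hm⟩ => h.2 hq hm⟩⟩
  · intro p hp
    exact conv _ {q | P.onVectors q p} (hv ⟨p, hp⟩).1 fun q => P.onVectors_iff q.2 hp
  · intro p hp
    exact conv _ {q | P.onVectors p q} (hv ⟨p, hp⟩).2.1 fun q => P.onVectors_iff hp q.2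
  · intro p hp
    refine conv _ {q | ¬ P.onVectors q p} (hv ⟨p, hp⟩).2.2.2 fun q => ?_
    change ¬ P.onVectors q p ↔ P ⟨p, hp⟩ q ∨ (¬ P ⟨p, hp⟩ q ∧ ¬ P q ⟨p, hp⟩)
    have e := P.onVectors_iff q.2 hp
    change P.onVectors q p ↔ _ at e
    rw [e]
    have := ha ⟨p, hp⟩ q
    change ¬ P q ⟨p, hp⟩ ↔ _
    tauto
  · intro p hp
    refine conv _ {q | ¬ P.onVectors p q} (hv ⟨p, hp⟩).2.2.1 fun q => ?_
    change ¬ P.onVectors p q ↔ P q ⟨p, hp⟩ ∨ (¬ P ⟨p, hp⟩ q ∧ ¬ P q ⟨p, hp⟩)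
    have e := P.onVectors_iff hp q.2
    change P.onVectors p q ↔ _ at e
    rw [e]
    have := ha ⟨p, hp⟩ q
    change ¬ P ⟨p, hp⟩ q ↔ _
    tauto
  · intro p hp q hq r hr t ht h1 h2
    have hmid : ∀ (x y : U → ℝ) (hx : x ∈ stdSimplex ℝ U) (hy : y ∈ stdSimplex ℝ U),
        midpoint ℝ x y = (Lottery.mid ⟨x, hx⟩ ⟨y, hy⟩ : Lottery U).1 := by
      intro x y hx hy
      rw [midpoint_eq_half]
      simp only [Lottery.mid, Lottery.mix]
      norm_num
      rfl
    have iff : ∀ x y : Lottery U, P.onVectors x.1 y.1 ↔ P x y := fun x y =>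
      P.onVectors_iff x.2 y.2
    rw [hmid p r hp hr] at h1
    rw [hmid p q hp hq] at h2
    rw [hmid r q hr hq]
    have := hs ⟨p, hp⟩ ⟨q, hq⟩ ⟨r, hr⟩ ⟨t, ht.1.le, ht.2.le⟩ ht.1 ht.2
      ⟨fun h => h1.1 ((iff _ _).2 h), fun h => h1.2 ((iff _ _).2 h)⟩
      ⟨fun h => h2.1 ((iff _ _).2 h), fun h => h2.2 ((iff _ _).2 h)⟩
    exact ⟨fun h => this.1 ((iff (Lottery.mix _ _ _) _).1 h),
      fun h => this.2 ((iff _ (Lottery.mix _ _ _)).1 h)⟩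

end PrefRel

/-! ### Gradients at positive vectors -/

section Gradient

variable {U : Type*} [Fintype U]

theorem exists_add_smul_mem_posCone {p : U → ℝ} (hp : p ∈ posCone U) (x : U → ℝ) :
    ∃ e > 0, ∀ t : ℝ, |t| ≤ e → p + t • x ∈ posCone U := by
  have hc : Continuous fun t : ℝ => p + t • x := by fun_prop
  have h0 : (fun t : ℝ => p + t • x) ⁻¹' posCone U ∈ nhds (0 : ℝ) :=
    (isOpen_posCone.preimage hc).mem_nhds (by simpa using hp)
  obtain ⟨e, he, h⟩ := Metric.mem_nhds_iff.1 h0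
  refine ⟨e / 2, by positivity, fun t ht => h ?_⟩
  rw [Metric.mem_ball, Real.dist_0_eq_abs]
  linarith

/-- The linear functional `g` separates the points above and below `p`. -/
def IsGradient (R : (U → ℝ) → (U → ℝ) → Prop) (p : U → ℝ) (g : (U → ℝ) →ₗ[ℝ] ℝ) : Prop :=
  ∀ y ∈ nonnegCone U, (R p y ↔ 0 < g y) ∧ (R y p ↔ g y < 0)

variable {R : (U → ℝ) → (U → ℝ) → Prop}

theorem IsGradient.smul {p : U → ℝ} {g : (U → ℝ) →ₗ[ℝ] ℝ} (hg : IsGradient R p g) {c : ℝ}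
    (hc : 0 < c) : IsGradient R p (c • g) := fun y hy => by
  rw [(hg y hy).1, (hg y hy).2, LinearMap.smul_apply, smul_eq_mul]
  exact ⟨(mul_pos_iff_of_pos_left hc).symm, (smul_neg_iff_of_pos_left hc).symm⟩

theorem IsGradient.smul_point (h : IsConeRel R) {p : U → ℝ} {g : (U → ℝ) →ₗ[ℝ] ℝ}
    (hg : IsGradient R p g) {c : ℝ} (hc : 0 < c) : IsGradient R (c • p) g := fun y hy => by
  rw [h.smul_left p y c hc, h.smul_right y p c hc]
  exact hg y hy

theorem IsGradient.indiff {p : U → ℝ} {g : (U → ℝ) →ₗ[ℝ] ℝ} (hg : IsGradient R p g) {y : U → ℝ}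
    (hy : y ∈ nonnegCone U) : (¬ R p y ∧ ¬ R y p) ↔ g y = 0 := by
  rw [(hg y hy).1, (hg y hy).2, not_lt, not_lt]
  exact ⟨fun h => le_antisymm h.1 h.2, fun h => ⟨h.le, h.ge⟩⟩

theorem IsConeRel.irrefl (h : IsConeRel R) {p : U → ℝ} (hp : p ∈ nonnegCone U) : ¬ R p p :=
  fun hpp => h.asymm p hp p hp hpp hpp

theorem IsGradient.apply_self (h : IsConeRel R) {p : U → ℝ} {g : (U → ℝ) →ₗ[ℝ] ℝ}
    (hg : IsGradient R p g) (hp : p ∈ nonnegCone U) : g p = 0 :=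
  (hg.indiff hp).1 ⟨h.irrefl hp, h.irrefl hp⟩

variable [Nonempty U]

/-- `p` is the sum of `e • x` and `p - e • x`; if the second summand were not below `p`, then `p`
would be above itself. -/
theorem IsConeRel.exists_below (h : IsConeRel R) {p x : U → ℝ} (hp : p ∈ posCone U)
    (hx : x ∈ posCone U) (hR : R x p) : ∃ z ∈ posCone U, R p z := by
  obtain ⟨e, he, hm⟩ := exists_add_smul_mem_posCone hp x
  have hz := hm (-e) (by rw [abs_neg, abs_of_pos he])
  refine ⟨_, hz, by_contra fun hn => ?_⟩
  have := h.add_left _ (posCone_subset (posCone_smul hx he)) _ (posCone_subset hz) p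
    (posCone_subset hp) ((h.smul_left x p e he).2 hR) hn
  have e1 : e • x + (p + (-e) • x) = p := by module
  rw [e1] at this
  exact h.irrefl (posCone_subset hp) this

theorem IsConeRel.isOpen_left (h : IsConeRel R) {p : U → ℝ} (hp : p ∈ nonnegCone U) :
    IsOpen {x | x ∈ posCone U ∧ R x p} := by
  rw [isOpen_iff_mem_nhds]
  rintro x ⟨hx, hR⟩
  have h1 := h.eventually_left x (posCone_subset hx) p hp hR
  have hn := isOpen_posCone.mem_nhds hx
  have h2 : nhdsWithin x (nonnegCone U) = nhds x :=
    nhdsWithin_eq_nhds.2 (Filter.mem_of_superset hn posCone_subset)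
  rw [h2] at h1
  filter_upwards [h1, hn] with y hy hy' using ⟨hy', hy⟩

theorem IsConeRel.convex_left (h : IsConeRel R) {p : U → ℝ} (hp : p ∈ nonnegCone U) :
    Convex ℝ {x | x ∈ posCone U ∧ R x p} := by
  rw [convex_iff_forall_pos]
  rintro x ⟨hx, hxp⟩ y ⟨hy, hyp⟩ a b ha hb -
  have hx' := posCone_smul hx ha
  have hy' := posCone_smul hy hb
  have hyp' := (h.smul_left y p b hb).2 hyp
  exact ⟨posCone_add hx' hy', h.add_left _ (posCone_subset hx') _ (posCone_subset hy') p hp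
    ((h.smul_left x p a ha).2 hxp) (h.asymm _ (posCone_subset hy') p hp hyp')⟩

/-- Adding `p`, which is indifferent to itself, moves `y` into the positive cone without changing
its comparison with `p`. -/
theorem isGradient_of_posCone (h : IsConeRel R) {p : U → ℝ} (hp : p ∈ posCone U)
    {g : (U → ℝ) →ₗ[ℝ] ℝ}
    (hg : ∀ y ∈ posCone U, (R p y ↔ 0 < g y) ∧ (R y p ↔ g y < 0)) : IsGradient R p g := by
  have hpC := posCone_subset hp
  have hgp : g p = 0 := le_antisymm
    (not_lt.1 fun h0 => h.irrefl hpC ((hg p hp).1.2 h0))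
    (not_lt.1 fun h0 => h.irrefl hpC ((hg p hp).2.2 h0))
  intro y hy
  have hyp : y + p ∈ posCone U := add_comm p y ▸ posCone_add_nonneg hp hy.1
  have e1 : R p y ↔ R p (y + p) :=
    ⟨fun h1 => h.add_right y hy p hpC p hpC h1 (h.irrefl hpC),
      fun h1 => by_contra fun hn => h.not_add_right y hy p hpC p hpC hn (h.irrefl hpC) h1⟩
  have e2 : R y p ↔ R (y + p) p :=
    ⟨fun h1 => h.add_left y hy p hpC p hpC h1 (h.irrefl hpC),
      fun h1 => by_contra fun hn => h.not_add_left y hy p hpC p hpC hn (h.irrefl hpC) h1⟩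
  rw [e1, e2, (hg _ hyp).1, (hg _ hyp).2, map_add, hgp, add_zero]
  exact ⟨Iff.rfl, Iff.rfl⟩

/-- The positive vectors above and those below `p` form open convex cones, both empty or both
nonempty. In the second case Hahn–Banach separates them, and invariance under scaling forces the
separating constant to be zero. -/
theorem IsConeRel.exists_isGradient (h : IsConeRel R) {p : U → ℝ} (hp : p ∈ posCone U) :
    ∃ g, IsGradient R p g := by
  have hpC := posCone_subset hp
  by_cases hne : ∃ x ∈ posCone U, R x p ∨ R p x
  · have hboth : (∃ x ∈ posCone U, R x p) ∧ ∃ z ∈ posCone U, R p z := by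
      obtain ⟨x, hx, hR | hR⟩ := hne
      · exact ⟨⟨x, hx, hR⟩, h.exists_below hp hx hR⟩
      · exact ⟨h.swap.exists_below hp hx hR, ⟨x, hx, hR⟩⟩
    obtain ⟨⟨x, hx, hxp⟩, z, hz, hpz⟩ := hboth
    obtain ⟨f, u, hf1, hf2⟩ := geometric_hahn_banach_open_open (h.convex_left hpC)
      (h.isOpen_left hpC) (h.swap.convex_left hpC) (h.swap.isOpen_left hpC)
      (Set.disjoint_left.2 fun y hy hy' =>
        h.asymm y (posCone_subset hy.1) p hpC hy.2 hy'.2)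
    have hu0 : 0 ≤ u := by
      by_contra hu
      push Not at hu
      have hk : 0 < u / f x := div_pos_of_neg_of_neg hu ((hf1 x ⟨hx, hxp⟩).trans hu)
      have := hf1 ((u / f x) • x) ⟨posCone_smul hx hk, (h.smul_left _ _ _ hk).2 hxp⟩
      rw [map_smul, smul_eq_mul, div_mul_cancel₀ _ ((hf1 x ⟨hx, hxp⟩).trans hu).ne] at this
      exact lt_irrefl _ this
    have hu1 : u ≤ 0 := by
      by_contra hu
      push Not at hu
      have hk : 0 < u / f z := div_pos hu (hu.trans (hf2 z ⟨hz, hpz⟩))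
      have := hf2 ((u / f z) • z) ⟨posCone_smul hz hk, (h.smul_right _ _ _ hk).2 hpz⟩
      rw [map_smul, smul_eq_mul, div_mul_cancel₀ _ (hu.trans (hf2 z ⟨hz, hpz⟩)).ne'] at this
      exact lt_irrefl _ this
    obtain rfl : u = 0 := le_antisymm hu1 hu0
    have hfx := hf1 x ⟨hx, hxp⟩
    have hfz := hf2 z ⟨hz, hpz⟩
    -- If `f y` were negative, adding the multiple of `z` that raises the value to 0 would give a
    -- vector strictly below `p`, where `f` is positive.
    have nonneg : ∀ y ∈ posCone U, ¬ R y p → 0 ≤ f y := by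
      intro y hy hR
      by_contra hn
      push Not at hn
      have hk : 0 < -f y / f z := div_pos (by linarith) hfz
      have hzk := posCone_smul hz hk
      have := hf2 ((-f y / f z) • z + y) ⟨posCone_add hzk hy,
        h.add_right _ (posCone_subset hzk) y (posCone_subset hy) p hpC
          ((h.smul_right _ _ _ hk).2 hpz) hR⟩
      rw [map_add, map_smul, smul_eq_mul, div_mul_cancel₀ _ hfz.ne'] at this
      linarith
    have nonpos : ∀ y ∈ posCone U, ¬ R p y → f y ≤ 0 := by
      intro y hy hR
      by_contra hn
      push Not at hn
      have hk : 0 < -f y / f x := div_pos_of_neg_of_neg (by linarith) hfx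
      have hxk := posCone_smul hx hk
      have := hf1 ((-f y / f x) • x + y) ⟨posCone_add hxk hy,
        h.add_left _ (posCone_subset hxk) y (posCone_subset hy) p hpC
          ((h.smul_left _ _ _ hk).2 hxp) hR⟩
      rw [map_add, map_smul, smul_eq_mul, div_mul_cancel₀ _ hfx.ne] at this
      linarith
    refine ⟨(f : (U → ℝ) →ₗ[ℝ] ℝ), isGradient_of_posCone h hp fun y hy => ⟨⟨fun hR => ?_,
      fun hf => ?_⟩, ⟨fun hR => ?_, fun hf => ?_⟩⟩⟩
    · exact hf2 y ⟨hy, hR⟩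
    · by_contra hn
      exact absurd (nonpos y hy hn) (not_le.2 hf)
    · exact hf1 y ⟨hy, hR⟩
    · by_contra hn
      exact absurd (nonneg y hy hn) (not_le.2 hf)
  · push Not at hne
    refine ⟨0, isGradient_of_posCone h hp fun y hy => ?_⟩
    simp [hne y hy]

/-- Both functionals vanish at `p`, so their signs at `y` are read off at the positive vector `p + e
• y`. -/
theorem IsGradient.pos_iff (h : IsConeRel R) {p : U → ℝ} (hp : p ∈ posCone U)
    {f g : (U → ℝ) →ₗ[ℝ] ℝ} (hf : IsGradient R p f) (hg : IsGradient R p g) (y : U → ℝ) :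
    0 < f y ↔ 0 < g y := by
  obtain ⟨e, he, hm⟩ := exists_add_smul_mem_posCone hp y
  have hy := posCone_subset (hm e (abs_of_pos he).le)
  have h1 := (hf _ hy).1.symm.trans (hg _ hy).1
  rw [map_add, map_add, map_smul, map_smul, hf.apply_self h (posCone_subset hp),
    hg.apply_self h (posCone_subset hp), zero_add, zero_add, smul_eq_mul, smul_eq_mul,
    mul_pos_iff_of_pos_left he, mul_pos_iff_of_pos_left he] at h1
  exact h1

/-- Two linear functionals that are positive on the same set are positively proportional. -/
theorem LinearMap.exists_eq_smul_of_pos_iff {E : Type*} [AddCommGroup E] [Module ℝ E]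
    {f g : E →ₗ[ℝ] ℝ} (h : ∀ y, 0 < f y ↔ 0 < g y) : ∃ c : ℝ, 0 < c ∧ g = c • f := by
  by_cases h0 : ∃ y, 0 < f y
  · obtain ⟨y, hy⟩ := h0
    have hgy := (h y).1 hy
    refine ⟨g y / f y, div_pos hgy hy, LinearMap.ext fun z => ?_⟩
    have hneg : ∀ y, f y < 0 ↔ g y < 0 := fun y => by
      have := h (-y); rwa [map_neg, map_neg, neg_pos, neg_pos] at this
    have hz : f (z - (f z / f y) • y) = 0 := by
      rw [map_sub, map_smul, smul_eq_mul, div_mul_cancel₀ _ hy.ne', sub_self]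
    have hz' : g (z - (f z / f y) • y) = 0 := le_antisymm
      (not_lt.1 fun hh => by have := (h _).2 hh; rw [hz] at this; exact lt_irrefl _ this)
      (not_lt.1 fun hh => by have := (hneg _).2 hh; rw [hz] at this; exact lt_irrefl _ this)
    rw [map_sub, map_smul, smul_eq_mul, sub_eq_zero] at hz'
    rw [hz', LinearMap.smul_apply, smul_eq_mul]
    field_simp
  · push Not at h0
    have zero : ∀ k : E →ₗ[ℝ] ℝ, (∀ y, k y ≤ 0) → k = 0 := fun k hk => LinearMap.ext fun y =>
      le_antisymm (hk y) (by simpa using hk (-y))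
    have hg0 : ∀ y, g y ≤ 0 := fun y => not_lt.1 fun hh => absurd ((h y).2 hh) (not_lt.2 (h0 y))
    exact ⟨1, one_pos, by rw [zero f h0, zero g hg0, smul_zero]⟩

theorem IsGradient.exists_eq_smul (h : IsConeRel R) {p : U → ℝ} (hp : p ∈ posCone U)
    {f g : (U → ℝ) →ₗ[ℝ] ℝ} (hf : IsGradient R p f) (hg : IsGradient R p g) :
    ∃ c : ℝ, 0 < c ∧ g = c • f :=
  LinearMap.exists_eq_smul_of_pos_iff (hf.pos_iff h hp hg)

theorem IsGradient.eq_of_apply_eq (h : IsConeRel R) {p : U → ℝ} (hp : p ∈ posCone U)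
    {f g : (U → ℝ) →ₗ[ℝ] ℝ} (hf : IsGradient R p f) (hg : IsGradient R p g) {y : U → ℝ}
    (hy : f y ≠ 0) (e : g y = f y) : g = f := by
  obtain ⟨c, hc, rfl⟩ := hf.exists_eq_smul h hp hg
  rw [LinearMap.smul_apply, smul_eq_mul] at e
  rw [(mul_eq_right₀ hy).1 e, one_smul]

end Gradient

/-! ### Affinity from a midpoint identity -/

section MidpointAffine

/-- A positive maximum lies in the interior; at its leftmost location the identity forces the same
value further to the left. -/
theorem nonpos_of_midpoint_condition {G : ℝ → ℝ} (hc : ContinuousOn G (Set.Icc 0 1))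
    (h0 : G 0 = 0) (h1 : G 1 = 0)
    (hJ : ∀ m ∈ Set.Ioo (0 : ℝ) 1, ∃ d > 0, m - d ∈ Set.Icc (0 : ℝ) 1 ∧
      m + d ∈ Set.Icc (0 : ℝ) 1 ∧ G (m - d) + G (m + d) = 2 * G m) :
    ∀ t ∈ Set.Icc (0 : ℝ) 1, G t ≤ 0 := by
  obtain ⟨M, hM, hmax⟩ := isCompact_Icc.exists_isMaxOn ⟨0, by simp⟩ hc
  have hmax' : ∀ t ∈ Set.Icc (0 : ℝ) 1, G t ≤ G M := fun t ht => hmax ht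
  by_contra hcon
  push Not at hcon
  obtain ⟨u, hu, hGu⟩ := hcon
  have hMpos : 0 < G M := hGu.trans_le (hmax' u hu)
  have hA : IsCompact (Set.Icc (0 : ℝ) 1 ∩ G ⁻¹' {G M}) :=
    isCompact_Icc.of_isClosed_subset (hc.preimage_isClosed_of_isClosed isClosed_Icc
      isClosed_singleton) Set.inter_subset_left
  obtain ⟨m, ⟨hm, hGm⟩, hmin⟩ := hA.exists_isLeast ⟨M, hM, rfl⟩
  rw [Set.mem_preimage, Set.mem_singleton_iff] at hGm
  have hm0 : m ≠ 0 := by rintro rfl; linarith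
  have hm1 : m ≠ 1 := by rintro rfl; linarith
  obtain ⟨d, hd, hl, hr, he⟩ := hJ m ⟨lt_of_le_of_ne hm.1 hm0.symm, lt_of_le_of_ne hm.2 hm1⟩
  have : m ≤ m - d := hmin ⟨hl, by
    rw [Set.mem_preimage, Set.mem_singleton_iff]
    linarith [hmax' _ hl, hmax' _ hr]⟩
  linarith

theorem eq_chord_of_midpoint_condition {g : ℝ → ℝ} (hc : ContinuousOn g (Set.Icc 0 1))
    (hJ : ∀ m ∈ Set.Ioo (0 : ℝ) 1, ∃ d > 0, m - d ∈ Set.Icc (0 : ℝ) 1 ∧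
      m + d ∈ Set.Icc (0 : ℝ) 1 ∧ g (m - d) + g (m + d) = 2 * g m) :
    ∀ t ∈ Set.Icc (0 : ℝ) 1, g t = (1 - t) * g 0 + t * g 1 := by
  intro t ht
  have h1 := nonpos_of_midpoint_condition (G := fun t => g t - ((1 - t) * g 0 + t * g 1))
    (hc.sub (by fun_prop)) (by simp) (by simp)
    (fun m hm => by
      obtain ⟨d, hd, hl, hr, he⟩ := hJ m hm
      exact ⟨d, hd, hl, hr, by linear_combination he⟩) t ht
  have h2 := nonpos_of_midpoint_condition (G := fun t => ((1 - t) * g 0 + t * g 1) - g t)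
    (ContinuousOn.sub (by fun_prop) hc) (by simp) (by simp)
    (fun m hm => by
      obtain ⟨d, hd, hl, hr, he⟩ := hJ m hm
      exact ⟨d, hd, hl, hr, by linear_combination -he⟩) t ht
  linarith

end MidpointAffine

/-! ### Gradients along a segment and their addition -/

section GradientAlongLine

variable {U : Type*} [Fintype U] [Nonempty U] {R : (U → ℝ) → (U → ℝ) → Prop}

/-- Gradients along a strictly ordered segment, normalized by their slope along the segment. -/
structure IsSlopeFamily (R : (U → ℝ) → (U → ℝ) → Prop) (p q : U → ℝ)
    (H : ℝ → (U → ℝ) →ₗ[ℝ] ℝ) : Prop where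
  isGradient : ∀ t ∈ Set.Icc (0 : ℝ) 1, IsGradient R (q + t • (p - q)) (H t)
  slope : ∀ t ∈ Set.Icc (0 : ℝ) 1, H t (p - q) = -1

omit [Fintype U] [Nonempty U] in
theorem segment_mem_posCone {p q : U → ℝ} (hp : p ∈ posCone U) (hq : q ∈ posCone U) {t : ℝ}
    (ht : t ∈ Set.Icc (0 : ℝ) 1) : q + t • (p - q) ∈ posCone U := by
  rcases eq_or_lt_of_le ht.1 with rfl | h0
  · simpa using hq
  · have e : q + t • (p - q) = t • p + (1 - t) • q := by module
    rw [e]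
    exact posCone_add_nonneg (posCone_smul hp h0) fun a =>
      mul_nonneg (by linarith [ht.2]) (hq a).le

theorem exists_isSlopeFamily (h : IsConeRel R) {p q : U → ℝ} (hp : p ∈ posCone U)
    (hq : q ∈ posCone U) (hR : R p q) : ∃ H, IsSlopeFamily R p q H := by
  have key : ∀ t ∈ Set.Icc (0 : ℝ) 1, ∃ g, IsGradient R (q + t • (p - q)) g ∧ g (p - q) = -1 := by
    intro t ht
    have hx := segment_mem_posCone hp hq ht
    obtain ⟨g, hg⟩ := h.exists_isGradient hx
    obtain ⟨g0, hg0⟩ := h.exists_isGradient hq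
    have hneg : g (p - q) < 0 := by
      have hz := hg.apply_self h (posCone_subset hx)
      have h0p := ((hg0 p (posCone_subset hp)).2).1 hR
      have h0q := hg0.apply_self h (posCone_subset hq)
      rcases eq_or_lt_of_le ht.1 with rfl | h0
      · rw [zero_smul, add_zero] at hg hz
        rw [map_sub, hz, sub_zero]
        exact ((hg p (posCone_subset hp)).2).1 hR
      · have h1 : R (q + t • (p - q)) q := by
          rw [(hg0 _ (posCone_subset hx)).2, map_add, map_smul, map_sub, h0q, smul_eq_mul]
          nlinarith
        have h2 := ((hg q (posCone_subset hq)).1).1 h1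
        rw [map_add, map_smul, smul_eq_mul] at hz
        by_contra hn
        push Not at hn
        nlinarith [mul_nonneg h0.le hn]
    refine ⟨(-1 / g (p - q)) • g, hg.smul (div_pos_of_neg_of_neg (by norm_num) hneg), ?_⟩
    rw [LinearMap.smul_apply, smul_eq_mul, div_mul_cancel₀ _ hneg.ne]
  choose! H hH using key
  exact ⟨H, fun t ht => (hH t ht).1, fun t ht => (hH t ht).2⟩

theorem IsSlopeFamily.apply_segment (h : IsConeRel R) {p q : U → ℝ}
    {H : ℝ → (U → ℝ) →ₗ[ℝ] ℝ} (hH : IsSlopeFamily R p q H) (hp : p ∈ posCone U)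
    (hq : q ∈ posCone U) {t : ℝ} (ht : t ∈ Set.Icc (0 : ℝ) 1) (s : ℝ) :
    H t (q + s • (p - q)) = t - s := by
  have hz := (hH.isGradient t ht).apply_self h (posCone_subset (segment_mem_posCone hp hq ht))
  have hs := hH.slope t ht
  rw [map_add, map_smul, hs, smul_eq_mul] at hz ⊢
  linarith

theorem IsSlopeFamily.continuousOn (h : IsConeRel R) {p q : U → ℝ}
    {H : ℝ → (U → ℝ) →ₗ[ℝ] ℝ} (hH : IsSlopeFamily R p q H) (hp : p ∈ posCone U)
    (hq : q ∈ posCone U) (y : U → ℝ) : ContinuousOn (fun t => H t y) (Set.Icc 0 1) := by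
  have lower : ∀ y : U → ℝ, ∀ t₀ ∈ Set.Icc (0 : ℝ) 1, ∀ e > 0,
      ∀ᶠ t in nhdsWithin t₀ (Set.Icc (0 : ℝ) 1), H t₀ y - e < H t y := by
    intro y t₀ ht₀ e he
    -- The shift makes `H t₀ w = e / 2`, so a small displacement along `w` leads strictly below the
    -- point at `t₀`. This preference persists for nearby `t`, which bounds `H t y` from below; the
    -- upper bound comes from `-y`.
    set w := y + (H t₀ y - e / 2) • (p - q) with hw
    have hx := segment_mem_posCone hp hq ht₀
    obtain ⟨d, hd, hm⟩ := exists_add_smul_mem_posCone hx w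
    have hz := hm d (abs_of_pos hd).le
    have hRz : R (q + t₀ • (p - q)) (q + t₀ • (p - q) + d • w) := by
      rw [((hH.isGradient t₀ ht₀) _ (posCone_subset hz)).1, map_add,
        hH.apply_segment h hp hq ht₀, map_smul, hw, map_add, map_smul, hH.slope t₀ ht₀,
        smul_eq_mul, smul_eq_mul]
      have : t₀ - t₀ + d * (H t₀ y + (H t₀ y - e / 2) * -1) = d * (e / 2) := by ring
      rw [this]; positivity
    have hev := h.eventually_left _ (posCone_subset hx) _ (posCone_subset hz) hRz
    have hcont : Filter.Tendsto (fun t : ℝ => q + t • (p - q))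
        (nhdsWithin t₀ (Set.Icc (0 : ℝ) 1))
        (nhdsWithin (q + t₀ • (p - q)) (nonnegCone U)) := by
      refine tendsto_nhdsWithin_iff.2 ⟨?_, ?_⟩
      · exact ((by fun_prop : Continuous fun t : ℝ => q + t • (p - q)).tendsto t₀).mono_left
          nhdsWithin_le_nhds
      · filter_upwards [self_mem_nhdsWithin] with t ht
        exact posCone_subset (segment_mem_posCone hp hq ht)
    have hclose : ∀ᶠ t in nhdsWithin t₀ (Set.Icc (0 : ℝ) 1), t - t₀ < d * (e / 2) := by
      refine Filter.Eventually.filter_mono nhdsWithin_le_nhds ?_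
      have : Continuous fun t : ℝ => t - t₀ := by fun_prop
      exact this.continuousAt.eventually_lt continuousAt_const
        (by rw [sub_self]; positivity)
    filter_upwards [hcont.eventually hev, hclose, self_mem_nhdsWithin] with t ht1 ht2 ht
    rw [((hH.isGradient t ht) _ (posCone_subset hz)).1, map_add,
      hH.apply_segment h hp hq ht, map_smul, hw, map_add, map_smul, hH.slope t ht,
      smul_eq_mul, smul_eq_mul] at ht1
    by_contra hn
    push Not at hn
    nlinarith [mul_le_mul_of_nonneg_left hn hd.le]
  intro t₀ ht₀
  rw [ContinuousWithinAt, tendsto_order]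
  constructor
  · intro a ha
    filter_upwards [lower y t₀ ht₀ (H t₀ y - a) (by linarith)] with t ht
    linarith
  · intro a ha
    filter_upwards [lower (-y) t₀ ht₀ (a - H t₀ y) (by linarith)] with t ht
    rw [map_neg, map_neg] at ht
    linarith

omit [Nonempty U] in
theorem sum_sub_of_mem {p q : U → ℝ} (hp : p ∈ stdSimplex ℝ U) (hq : q ∈ stdSimplex ℝ U) :
    ∑ a, (p - q) a = 0 := by
  simp [Finset.sum_sub_distrib, hp.2, hq.2]

/-- This is where symmetry constrains the gradients. An outcome `q₀` off the segment is indifferent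
to `x m`, and some `x (m + d)` is indifferent to the midpoint of `x (m + D)` and `q₀`. Symmetry
mirrors this to `x (m - d)` and `x (m - D)`; when the two gradient equations are added, `d` and `D`
cancel. -/
theorem IsSlopeFamily.midpoint_condition (h : IsConeRel R) {p q : U → ℝ}
    {H : ℝ → (U → ℝ) →ₗ[ℝ] ℝ} (hH : IsSlopeFamily R p q H) (hp : p ∈ posCone U)
    (hq : q ∈ posCone U) (hpS : p ∈ stdSimplex ℝ U) (hqS : q ∈ stdSimplex ℝ U) (y : U → ℝ)
    {m : ℝ} (hm : m ∈ Set.Ioo (0 : ℝ) 1) :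
    ∃ d > 0, m - d ∈ Set.Icc (0 : ℝ) 1 ∧ m + d ∈ Set.Icc (0 : ℝ) 1 ∧
      H (m - d) y + H (m + d) y = 2 * H m y := by
  have hmI : m ∈ Set.Icc (0 : ℝ) 1 := ⟨hm.1.le, hm.2.le⟩
  set x : ℝ → (U → ℝ) := fun t => q + t • (p - q) with hx
  have hxO : ∀ t ∈ Set.Icc (0 : ℝ) 1, x t ∈ posCone U := fun t ht => segment_mem_posCone hp hq ht
  have hxC : ∀ t ∈ Set.Icc (0 : ℝ) 1, x t ∈ nonnegCone U := fun t ht => posCone_subset (hxO t ht)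
  have hxsum : ∀ t, ∑ a, x t a = 1 := by
    intro t
    simp only [hx, Pi.add_apply, Pi.smul_apply, smul_eq_mul, Finset.sum_add_distrib,
      ← Finset.mul_sum, sum_sub_of_mem hpS hqS, hqS.2, mul_zero, add_zero]
  have hxS : ∀ t ∈ Set.Icc (0 : ℝ) 1, x t ∈ stdSimplex ℝ U := fun t ht =>
    ⟨(hxC t ht).1, hxsum t⟩
  have hseg : ∀ t ∈ Set.Icc (0 : ℝ) 1, ∀ s, H t (x s) = t - s := fun t ht s =>
    hH.apply_segment h hp hq ht s
  have hgr : ∀ t ∈ Set.Icc (0 : ℝ) 1, IsGradient R (x t) (H t) := hH.isGradient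
  -- The correction changes `H t y` by an affine function of `t`, so the identity for `w` gives the
  -- one for `y`. It also makes `H m w` and the coordinate sum of `w` vanish.
  set w : U → ℝ := y - (∑ a, y a) • x m + (H m y) • (p - q) with hw
  have hwm : H m w = 0 := by
    rw [hw, map_add, map_sub, map_smul, map_smul, hseg m hmI, hH.slope m hmI]
    simp
  have hwsum : ∑ a, w a = 0 := by
    simp only [hw, Pi.add_apply, Pi.sub_apply, Pi.smul_apply, smul_eq_mul,
      Finset.sum_add_distrib, Finset.sum_sub_distrib, ← Finset.mul_sum, hxsum, hpS.2, hqS.2]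
    ring
  set D : ℝ := min m (1 - m) with hD
  have hD0 : 0 < D := lt_min hm.1 (by linarith [hm.2])
  have hDm : D ≤ m := min_le_left _ _
  have hDm1 : D ≤ 1 - m := min_le_right _ _
  have hmD : m - D ∈ Set.Icc (0 : ℝ) 1 := ⟨by linarith, by linarith [hm.2]⟩
  have hmD' : m + D ∈ Set.Icc (0 : ℝ) 1 := ⟨by linarith [hm.1], by linarith⟩
  obtain ⟨e₀, he₀, hmem⟩ := exists_add_smul_mem_posCone (hxO m hmI) w
  set A := |H (m + D) w| + |H (m - D) w| + 1 with hA
  have hA0 : 0 < A := by positivity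
  -- Small enough that `q₀` is positive and that the terms `± D` decide the signs of `H (m ± D) q₀`.
  set e : ℝ := min e₀ (D / (2 * A)) with he
  have hepos : 0 < e := lt_min he₀ (by positivity)
  have heA : e * A ≤ D / 2 := by
    have : e ≤ D / (2 * A) := min_le_right _ _
    calc e * A ≤ D / (2 * A) * A := by gcongr
      _ = D / 2 := by field_simp
  have hq₀O := hmem e (by rw [abs_of_pos hepos]; exact min_le_left _ _)
  set q₀ : U → ℝ := x m + e • w with hq₀
  have hq₀S : q₀ ∈ stdSimplex ℝ U := ⟨fun a => (hq₀O a).le, by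
    simp only [hq₀, Pi.add_apply, Pi.smul_apply, smul_eq_mul, Finset.sum_add_distrib,
      ← Finset.mul_sum, hwsum, hxsum, mul_zero, add_zero]⟩
  have hHq₀ : ∀ t ∈ Set.Icc (0 : ℝ) 1, H t q₀ = t - m + e * H t w := fun t ht => by
    rw [hq₀, map_add, map_smul, hseg t ht, smul_eq_mul]
  have hup : 0 < H (m + D) q₀ := by
    rw [hHq₀ _ hmD']
    have : -|H (m + D) w| ≤ H (m + D) w := neg_abs_le _
    have h2 : -A ≤ H (m + D) w := by
      rw [hA]; linarith [abs_nonneg (H (m - D) w)]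
    nlinarith [mul_le_mul_of_nonneg_left h2 hepos.le]
  have hlo : H (m - D) q₀ < 0 := by
    rw [hHq₀ _ hmD]
    have : H (m - D) w ≤ |H (m - D) w| := le_abs_self _
    have h2 : H (m - D) w ≤ A := by
      rw [hA]; linarith [abs_nonneg (H (m + D) w)]
    nlinarith [mul_le_mul_of_nonneg_left h2 hepos.le]
  set z : U → ℝ := x (m + D) + q₀ with hz
  have hzO : z ∈ posCone U := posCone_add (hxO _ hmD') hq₀O
  have hzC := posCone_subset hzO
  obtain ⟨g, hg⟩ := h.exists_isGradient hzO
  have hgP : g (x (m + D)) < 0 := by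
    rw [← (hg _ (hxC _ hmD')).2, ((hgr _ hmD') z hzC).1, hz, map_add, hseg _ hmD']
    linarith
  have hgm : 0 < g (x m) := by
    rw [← (hg _ (hxC _ hmI)).1, ((hgr _ hmI) z hzC).2, hz, map_add, hseg _ hmI, hHq₀ _ hmI, hwm]
    linarith
  have hgx : ∀ s, g (x s) = g (x m) + (s - m) * g (p - q) := by
    intro s
    have : x s = x m + (s - m) • (p - q) := by simp only [hx]; module
    rw [this, map_add, map_smul, smul_eq_mul]
  have hgD := hgx (m + D)
  rw [add_sub_cancel_left] at hgD
  have hgn : g (p - q) < 0 := by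
    by_contra hn
    push Not at hn
    nlinarith [mul_nonneg hD0.le hn]
  -- The zero of `g` on the segment is at `m + d`, between the sign change from `x m` to `x (m +
  -- D)`.
  set d : ℝ := g (x m) / -g (p - q) with hd
  have hd0 : 0 < d := div_pos hgm (by linarith)
  have hdD : d < D := by
    rw [hd, div_lt_iff₀ (by linarith)]
    linarith
  have hmd : m - d ∈ Set.Icc (0 : ℝ) 1 := ⟨by linarith, by linarith [hm.2]⟩
  have hmd' : m + d ∈ Set.Icc (0 : ℝ) 1 := ⟨by linarith [hm.1], by linarith⟩
  have hgd : g (x (m + d)) = 0 := by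
    rw [hgx, add_sub_cancel_left, hd, div_neg, neg_mul, div_mul_cancel₀ _ hgn.ne]
    ring
  have hts : ((D + d) / (2 * D)) • x (m + D) + (1 - (D + d) / (2 * D)) • x (m - D) = x (m + d) := by
    have h1 : (D + d) / (2 * D) = 1 / 2 + d / (2 * D) := by field_simp
    have h2 : d / (2 * D) * (2 * D) = d := by field_simp
    have : x (m + d) = x (m + d / (2 * D) * (2 * D)) := by rw [h2]
    rw [this, h1]
    simp only [hx]
    module
  have hts' : ((D + d) / (2 * D)) • x (m - D) + (1 - (D + d) / (2 * D)) • x (m + D) =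
      x (m - d) := by
    have h1 : (D + d) / (2 * D) = 1 / 2 + d / (2 * D) := by field_simp
    have h2 : d / (2 * D) * (2 * D) = d := by field_simp
    have : x (m - d) = x (m - d / (2 * D) * (2 * D)) := by rw [h2]
    rw [this, h1]
    simp only [hx]
    module
  have hI1 : ¬ R (x (m + d)) z ∧ ¬ R z (x (m + d)) := ((hg.indiff (hxC _ hmd')).2 hgd).symm
  have hsym := h.symm (x (m + D)) (hxS _ hmD') q₀ hq₀S (x (m - D)) (hxS _ hmD)
    ((D + d) / (2 * D)) ⟨by positivity, by rw [div_lt_one (by positivity)]; linarith⟩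
    (by
      have e2 : x (m + D) + x (m - D) = (2 : ℝ) • x m := by simp only [hx]; module
      rw [e2, h.smul_left _ _ _ two_pos, h.smul_right _ _ _ two_pos]
      exact (((hgr m hmI).indiff (posCone_subset hq₀O)).2
        (by rw [hHq₀ m hmI, hwm]; ring)).symm)
    (by rw [hts]; exact hI1)
  rw [hts'] at hsym
  have k1 := ((hgr _ hmd').indiff hzC).1 hI1
  have k2 := ((hgr _ hmd).indiff (nonnegCone_add (hxC _ hmD) (posCone_subset hq₀O))).1 hsym
  rw [hz, map_add, hseg _ hmd', hHq₀ _ hmd'] at k1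
  rw [map_add, hseg _ hmd, hHq₀ _ hmd] at k2
  have k3 : H (m + d) w + H (m - d) w = 0 := by
    have : e * (H (m + d) w + H (m - d) w) = 0 := by linear_combination k1 + k2
    exact (mul_eq_zero.1 this).resolve_left hepos.ne'
  have hHw : ∀ t ∈ Set.Icc (0 : ℝ) 1, H t w = H t y - (∑ a, y a) * (t - m) - H m y := by
    intro t ht
    rw [hw, map_add, map_sub, map_smul, map_smul, hseg t ht, hH.slope t ht, smul_eq_mul,
      smul_eq_mul]
    ring
  rw [hHw _ hmd, hHw _ hmd'] at k3
  exact ⟨d, hd0, hmd, hmd', by linear_combination k3⟩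

/-- Suitably scaled gradients at the ends of a segment add up to a gradient at the sum. -/
theorem IsGradient.add (h : IsConeRel R) {p q : U → ℝ} {f g : (U → ℝ) →ₗ[ℝ] ℝ}
    (hf : IsGradient R p f) (hg : IsGradient R q g) (hp : p ∈ posCone U) (hq : q ∈ posCone U)
    (hR : R p q) (hfg : f q + g p = 0) : IsGradient R (p + q) (f + g) := by
  have hpC := posCone_subset hp
  have hqC := posCone_subset hq
  have hP := hpC.2
  have hQ := hqC.2
  set P := ∑ a, p a with hPdef
  set Q := ∑ a, q a with hQdef
  have hp' : P⁻¹ • p ∈ posCone U := posCone_smul hp (inv_pos.2 hP)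
  have hq' : Q⁻¹ • q ∈ posCone U := posCone_smul hq (inv_pos.2 hQ)
  have hR' : R (P⁻¹ • p) (Q⁻¹ • q) := by
    rwa [h.smul_left _ _ _ (inv_pos.2 hP), h.smul_right _ _ _ (inv_pos.2 hQ)]
  obtain ⟨H, hH⟩ := exists_isSlopeFamily h hp' hq' hR'
  have hG : 0 < f q := ((hf q hqC).1).1 hR
  have hgp : g p = -f q := by linarith
  have m0 : (0 : ℝ) ∈ Set.Icc (0 : ℝ) 1 := by simp
  have m1 : (1 : ℝ) ∈ Set.Icc (0 : ℝ) 1 := by simp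
  have hH1 : H 1 = (Q / f q) • f := by
    have h1 := hH.isGradient 1 m1
    rw [one_smul, add_sub_cancel] at h1
    have hf' := (hf.smul_point h (inv_pos.2 hP)).smul (c := Q / f q) (by positivity)
    have v1 : ((Q / f q) • f) (Q⁻¹ • q) = 1 := by
      rw [LinearMap.smul_apply, map_smul, smul_eq_mul, smul_eq_mul]; field_simp
    refine hf'.eq_of_apply_eq h hp' h1 (y := Q⁻¹ • q) (by rw [v1]; norm_num) ?_
    have := hH.apply_segment h hp' hq' m1 0
    rw [zero_smul, add_zero] at this
    rw [v1, this, sub_zero]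
  have hH0 : H 0 = (P / f q) • g := by
    have h1 := hH.isGradient 0 m0
    rw [zero_smul, add_zero] at h1
    have hg' := (hg.smul_point h (inv_pos.2 hQ)).smul (c := P / f q) (by positivity)
    have v1 : ((P / f q) • g) (P⁻¹ • p) = -1 := by
      rw [LinearMap.smul_apply, map_smul, smul_eq_mul, smul_eq_mul, hgp]; field_simp
    refine hg'.eq_of_apply_eq h hq' h1 (y := P⁻¹ • p) (by rw [v1]; norm_num) ?_
    have := hH.apply_segment h hp' hq' m0 1
    rw [one_smul, add_sub_cancel] at this
    rw [v1, this, zero_sub]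
  have mt : P / (P + Q) ∈ Set.Icc (0 : ℝ) 1 :=
    ⟨by positivity, by rw [div_le_one (by positivity)]; linarith⟩
  -- The ray of `p + q` meets the normalized segment at the parameter `P / (P + Q)`, where the chord
  -- gives `f` and `g` the same coefficient.
  have hHt : H (P / (P + Q)) = (P * Q / (f q * (P + Q))) • (f + g) := by
    refine LinearMap.ext fun y => ?_
    have := eq_chord_of_midpoint_condition (hH.continuousOn h hp' hq' y)
      (fun m hm => hH.midpoint_condition h hp' hq' (normalizeSum_mem hpC) (normalizeSum_mem hqC)
        _ hm) _ mt
    rw [this, hH0, hH1]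
    simp only [LinearMap.smul_apply, LinearMap.add_apply, smul_eq_mul]
    field_simp
    ring
  have hgrad := hH.isGradient _ mt
  have e1 : Q⁻¹ • q + (P / (P + Q)) • (P⁻¹ • p - Q⁻¹ • q) = (P + Q)⁻¹ • (p + q) := by
    rw [smul_sub, smul_smul, smul_smul, smul_add]
    have c1 : P / (P + Q) * P⁻¹ = (P + Q)⁻¹ := by field_simp
    have c2 : P / (P + Q) * Q⁻¹ = Q⁻¹ - (P + Q)⁻¹ := by field_simp; ring
    rw [c1, c2]
    module
  rw [e1, hHt] at hgrad
  have := (hgrad.smul_point h (c := P + Q) (by positivity)).smul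
    (c := f q * (P + Q) / (P * Q)) (by positivity)
  rw [smul_smul, smul_smul, mul_inv_cancel₀ (by positivity), one_smul] at this
  convert this using 1
  rw [show f q * (P + Q) / (P * Q) * (P * Q / (f q * (P + Q))) = 1 by field_simp, one_smul]

end GradientAlongLine

/-! ### Assembly of a skew-symmetric form -/

section SkewRepresentation

variable {U : Type*} [Fintype U] [Nonempty U] {R : (U → ℝ) → (U → ℝ) → Prop}

/-- Scaling `f` and `g` against the common reference `k` already makes them consistent with each
other. Let `f q = -(c * g p)`. The two bracketings of `r + q + p` give proportional gradients, and
comparing their values at `r` and at `p` yields `A ^ 2 * B * E * (c - 1) ^ 2 = 0`. -/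
theorem gradient_cocycle_of_lt (h : IsConeRel R) {p q r : U → ℝ} {f g k : (U → ℝ) →ₗ[ℝ] ℝ}
    (hp : p ∈ posCone U) (hq : q ∈ posCone U) (hr : r ∈ posCone U)
    (hf : IsGradient R p f) (hg : IsGradient R q g) (hk : IsGradient R r k)
    (hrp : R r p) (hrq : R r q) (hqp : R q p) (hfk : f r = -k p) (hgk : g r = -k q) :
    f q = -g p := by
  have hpC := posCone_subset hp
  have hqC := posCone_subset hq
  have hrC := posCone_subset hr
  have fp := hf.apply_self h hpC
  have gq := hg.apply_self h hqC
  have kr := hk.apply_self h hrC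
  have hA : 0 < k p := (hk p hpC).1.1 hrp
  have hB : 0 < k q := (hk q hqC).1.1 hrq
  have hE : 0 < g p := (hg p hpC).1.1 hqp
  have hfq : f q < 0 := (hf q hqC).2.1 hqp
  obtain ⟨c, hc, hcE⟩ : ∃ c : ℝ, 0 < c ∧ f q = -(c * g p) :=
    ⟨-f q / g p, div_pos (by linarith) hE, by field_simp⟩
  set A := k p
  set B := k q
  set E := g p
  have g1 := (hg.smul hc).add h hf hq hp hqp (by
    rw [LinearMap.smul_apply, smul_eq_mul, hcE]; ring)
  have hqpO := posCone_add hq hp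
  have g2 := hk.add h (g1.smul (c := (A + B) / (A + c * B)) (by positivity)) hr hqpO
    (by rw [(hk _ (posCone_subset hqpO)).1, map_add]; positivity)
    (by
      simp only [LinearMap.smul_apply, LinearMap.add_apply, smul_eq_mul, map_add, hfk, hgk]
      field_simp
      ring)
  have g3 := hk.add h hg hr hq hrq (by rw [hgk]; ring)
  have hrqO := posCone_add hr hq
  have g4 := g3.add h (hf.smul (c := (A + E) / (A + c * E)) (by positivity)) hrqO hp
    (by rw [(g3 p hpC).1, LinearMap.add_apply]; positivity)
    (by
      simp only [LinearMap.smul_apply, LinearMap.add_apply, smul_eq_mul, map_add, hfk, hcE]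
      field_simp
      ring)
  rw [← add_assoc] at g2
  obtain ⟨μ, hμ, e⟩ := g2.exists_eq_smul h (posCone_add hrqO hp) g4
  have er := LinearMap.congr_fun e r
  have ep := LinearMap.congr_fun e p
  simp only [LinearMap.smul_apply, LinearMap.add_apply, smul_eq_mul, hfk, hgk, kr, fp] at er ep
  change A + E + _ = μ * (A + (A + B) / (A + c * B) * (c * E + 0)) at ep
  have e1 : (A + B) / (A + c * B) * (c * -B + -A) = -(A + B) := by field_simp; ring
  rw [e1] at er
  have cross : (B + (A + E) / (A + c * E) * A) * (A + (A + B) / (A + c * B) * (c * E)) =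
      (A + E) * (A + B) := by
    have h1 : B + (A + E) / (A + c * E) * A = μ * (A + B) := by linear_combination -er
    have h2 : A + E = μ * (A + (A + B) / (A + c * B) * (c * E)) := by linear_combination ep
    rw [h1, h2]; ring
  field_simp at cross
  have key : A ^ 2 * B * E * (c - 1) ^ 2 = 0 := by
    linear_combination -cross
  have hc1 : c = 1 := by
    have h1 : A ^ 2 * B * E ≠ 0 := by positivity
    have h2 := (mul_eq_zero.1 key).resolve_left h1
    have h3 := pow_eq_zero_iff (two_ne_zero) |>.1 h2
    linarith
  rw [hcE, hc1, one_mul]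

theorem gradient_cocycle (h : IsConeRel R) {p q r : U → ℝ} {f g k : (U → ℝ) →ₗ[ℝ] ℝ}
    (hp : p ∈ posCone U) (hq : q ∈ posCone U) (hr : r ∈ posCone U)
    (hf : IsGradient R p f) (hg : IsGradient R q g) (hk : IsGradient R r k)
    (hrp : R r p) (hrq : R r q) (hfk : f r = -k p) (hgk : g r = -k q) :
    f q = -g p := by
  by_cases h1 : R q p
  · exact gradient_cocycle_of_lt h hp hq hr hf hg hk hrp hrq h1 hfk hgk
  by_cases h2 : R p q
  · rw [gradient_cocycle_of_lt h hq hp hr hg hf hk hrq hrp h2 hgk hfk, neg_neg]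
  · rw [(hf.indiff (posCone_subset hq)).1 ⟨h2, h1⟩, (hg.indiff (posCone_subset hp)).1 ⟨h1, h2⟩,
      neg_zero]

/-- On the open set `V` of positive vectors below `r`, gradients can be scaled against that of `r`.
The cocycle identity makes `H p q` skew there, hence also linear in the point `p`, and `V` is large
enough to determine a bilinear form. -/
theorem IsConeRel.exists_skew_gradient (h : IsConeRel R) :
    ∃ B : (U → ℝ) →ₗ[ℝ] (U → ℝ) →ₗ[ℝ] ℝ, (∀ x y, B x y = -B y x) ∧
      ∀ p ∈ posCone U, IsGradient R p (B p) := by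
  by_cases hne : ∃ r ∈ posCone U, ∃ o ∈ posCone U, R r o
  swap
  · push Not at hne
    refine ⟨0, by simp, fun p hp => isGradient_of_posCone h hp fun y hy => ?_⟩
    simp [hne p hp y hy, hne y hy p hp]
  obtain ⟨r, hr, o, ho, hro⟩ := hne
  obtain ⟨k, hk⟩ := h.exists_isGradient hr
  set V : Set (U → ℝ) := {x | x ∈ posCone U ∧ R r x} with hV
  have hVo : IsOpen V := h.swap.isOpen_left (posCone_subset hr)
  have hVmem : ∀ x ∈ V, ∀ y : U → ℝ, ∃ e : ℝ, 0 < e ∧ x + e • y ∈ V := by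
    intro x hx y
    have hc : Continuous fun t : ℝ => x + t • y := by fun_prop
    have h0 : (fun t : ℝ => x + t • y) ⁻¹' V ∈ nhds (0 : ℝ) :=
      (hVo.preimage hc).mem_nhds (by simpa using hx)
    obtain ⟨e, he, h⟩ := Metric.mem_nhds_iff.1 h0
    refine ⟨e / 2, by positivity, h ?_⟩
    rw [Metric.mem_ball, Real.dist_0_eq_abs, abs_of_pos (by positivity)]
    linarith
  have hoV : o ∈ V := ⟨ho, hro⟩
  have heq : ∀ f g : (U → ℝ) →ₗ[ℝ] ℝ, (∀ y ∈ V, f y = g y) → f = g := by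
    intro f g hfg
    refine LinearMap.ext fun x => ?_
    obtain ⟨e, he, hm⟩ := hVmem o hoV x
    have h1 := hfg _ hm
    rw [map_add, map_add, hfg o hoV, map_smul, map_smul, add_right_inj, smul_eq_mul,
      smul_eq_mul] at h1
    exact mul_left_cancel₀ he.ne' h1
  have hex : ∀ p ∈ V, ∃ g, IsGradient R p g ∧ g r = -k p := by
    rintro p ⟨hp, hrp⟩
    obtain ⟨g, hg⟩ := h.exists_isGradient hp
    have hgr : g r < 0 := (hg r (posCone_subset hr)).2.1 hrp
    have hkp : 0 < k p := (hk p (posCone_subset hp)).1.1 hrp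
    exact ⟨(-k p / g r) • g, hg.smul (div_pos_of_neg_of_neg (by linarith) hgr), by
      rw [LinearMap.smul_apply, smul_eq_mul, div_mul_cancel₀ _ hgr.ne]⟩
  choose! H hH hHr using hex
  have hskew : ∀ p ∈ V, ∀ q ∈ V, H p q = -H q p := fun p hp q hq =>
    gradient_cocycle h hp.1 hq.1 hr (hH p hp) (hH q hq) hk hp.2 hq.2 (hHr p hp) (hHr q hq)
  classical
  -- The rows of `B` are difference quotients of `H` at `o` in the coordinate directions.
  choose e he hev using fun a : U => hVmem o hoV (fun j => if a = j then 1 else 0)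
  set v : U → (U → ℝ) := fun a => o + e a • (fun j => if a = j then 1 else 0) with hv
  let B : (U → ℝ) →ₗ[ℝ] (U → ℝ) →ₗ[ℝ] ℝ :=
    LinearMap.mk₂ ℝ (fun x y => ∑ a, x a * ((e a)⁻¹ * (H (v a) y - H o y)))
      (fun x x' y => by simp only [Pi.add_apply, add_mul, Finset.sum_add_distrib])
      (fun c x y => by
        simp only [Pi.smul_apply, smul_eq_mul, Finset.mul_sum, mul_assoc])
      (fun x y y' => by
        rw [← Finset.sum_add_distrib]
        refine Finset.sum_congr rfl fun a _ => ?_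
        rw [map_add, map_add]; ring)
      (fun c x y => by
        rw [smul_eq_mul, Finset.mul_sum]
        refine Finset.sum_congr rfl fun a _ => ?_
        rw [map_smul, map_smul, smul_eq_mul, smul_eq_mul]; ring)
  have hB1 : ∀ x, ∀ y ∈ V, B x y = -H y x := by
    intro x y hy
    rw [LinearMap.mk₂_apply, LinearMap.pi_apply_eq_sum_univ (H y) x, ← Finset.sum_neg_distrib]
    refine Finset.sum_congr rfl fun a _ => ?_
    rw [hskew _ (hev a) y hy, hskew o hoV y hy, map_add, map_smul, smul_eq_mul, smul_eq_mul]
    have := (he a).ne'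
    field_simp
    ring
  have hBH : ∀ p ∈ V, B p = H p := fun p hp => heq _ _ fun y hy => by
    rw [hB1 p y hy, hskew p hp y hy]
  have hBskew : ∀ x y, B x y = -B y x := by
    intro x
    have : B x = -(B.flip x) := heq _ _ fun y hy => by
      rw [hB1 x y hy, LinearMap.neg_apply, LinearMap.flip_apply, hBH y hy]
    intro y
    rw [this, LinearMap.neg_apply, LinearMap.flip_apply]
  have hBself : ∀ x, B x x = 0 := fun x => by have := hBskew x x; linarith
  refine ⟨B, hBskew, fun p hp => ?_⟩
  have hpC := posCone_subset hp
  obtain ⟨f, hf⟩ := h.exists_isGradient hp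
  by_cases hz : ∀ y ∈ V, f y = 0
  · have hf0 : f = 0 := heq _ _ fun y hy => hz y hy
    have hB0 : B p = 0 := heq _ _ fun y hy => by
      rw [hB1 p y hy, LinearMap.zero_apply, neg_eq_zero]
      exact ((hH y hy).indiff hpC).1 ((hf.indiff (posCone_subset hy.1)).2 (hz y hy)).symm
    rwa [hB0, ← hf0]
  · push Not at hz
    obtain ⟨y, hy, hfy⟩ := hz
    have hyC := posCone_subset hy.1
    have hHy : H y p ≠ 0 := fun h0 => hfy
      ((hf.indiff hyC).1 (((hH y hy).indiff hpC).2 h0).symm)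
    have hc : 0 < -H y p / f y := by
      rcases lt_or_gt_of_ne hfy with hlt | hgt
      · exact div_pos_of_neg_of_neg
          (neg_lt_zero.2 (((hH y hy) p hpC).1.1 ((hf y hyC).2.2 hlt))) hlt
      · exact div_pos (neg_pos.2 (((hH y hy) p hpC).2.1 ((hf y hyC).1.2 hgt))) hgt
    have hf' := hf.smul hc
    set f' := (-H y p / f y) • f with hf'def
    have hf'y : f' y = -H y p := by
      rw [hf'def, LinearMap.smul_apply, smul_eq_mul, div_mul_cancel₀ _ hfy]
    -- For `p` outside `V`, both `H y + s • f'` and `H y + s • B p` are gradients at `y + s • p`,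
    -- which lies in `V`. They take the same nonzero value at `p`, so they coincide.
    obtain ⟨s, hs, hsV⟩ := hVmem y hy p
    have hsp := posCone_smul hp hs
    have hsum : IsGradient R (y + s • p) (H y + s • f') := by
      have hf's := (hf'.smul_point h hs).smul hs
      by_cases hR : R y p
      · exact (hH y hy).add h hf's hy.1 hsp ((h.smul_right _ _ _ hs).2 hR) (by
          rw [LinearMap.smul_apply, map_smul, hf'y, smul_eq_mul, smul_eq_mul]; ring)
      · have hR' : R p y := by
          by_contra hn
          exact hHy (((hH y hy).indiff hpC).1 ⟨hR, hn⟩)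
        rw [add_comm y, add_comm (H y)]
        exact hf's.add h (hH y hy) hsp hy.1 ((h.smul_left _ _ _ hs).2 hR') (by
          rw [LinearMap.smul_apply, map_smul, hf'y, smul_eq_mul, smul_eq_mul]; ring)
    have hf'p : f' p = 0 := hf'.apply_self h hpC
    have e1 : B (y + s • p) = H y + s • B p := by rw [map_add, map_smul, hBH y hy]
    have hBsum : IsGradient R (y + s • p) (H y + s • B p) := by
      rw [← e1, hBH _ hsV]; exact hH _ hsV
    have := hsum.eq_of_apply_eq h hsV.1 hBsum (y := p)
      (by simpa [hf'p] using hHy) (by simp [hf'p, hBself])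
    rw [add_right_inj] at this
    have hfB : B p = f' := by
      have := congrArg (fun l => s⁻¹ • l) this
      simpa [smul_smul, inv_mul_cancel₀ hs.ne'] using this
    rw [hfB]
    exact hf'

/-- Gradients are available only at positive vectors. Boundary vectors `p` and `q` are therefore
each compared with `p + q` after a shift by a small multiple of the positive vector `o`. -/
theorem IsConeRel.exists_skew (h : IsConeRel R) :
    ∃ B : (U → ℝ) →ₗ[ℝ] (U → ℝ) →ₗ[ℝ] ℝ, (∀ x y, B x y = -B y x) ∧
      ∀ p ∈ nonnegCone U, ∀ q ∈ nonnegCone U, R p q ↔ 0 < B p q := by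
  obtain ⟨B, hskew, hgrad⟩ := h.exists_skew_gradient
  have hself : ∀ x, B x x = 0 := fun x => by have := hskew x x; linarith
  set o : U → ℝ := fun _ => 1 with ho
  have hoO : o ∈ posCone U := fun _ => one_pos
  have hO : ∀ p ∈ nonnegCone U, ∀ e : ℝ, 0 < e → p + e • o ∈ posCone U := fun p hp e he =>
    add_comm (e • o) p ▸ posCone_add_nonneg (posCone_smul hoO he) hp.1
  have hlim : ∀ p ∈ nonnegCone U, Filter.Tendsto (fun e : ℝ => p + e • o)
      (nhdsWithin 0 (Set.Ioi 0)) (nhdsWithin p (nonnegCone U)) := by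
    intro p hp
    refine tendsto_nhdsWithin_iff.2 ⟨?_, ?_⟩
    · have : Continuous fun e : ℝ => p + e • o := by fun_prop
      have h1 := this.tendsto 0
      rw [zero_smul, add_zero] at h1
      exact h1.mono_left nhdsWithin_le_nhds
    · filter_upwards [self_mem_nhdsWithin] with e he
      exact posCone_subset (hO p hp e he)
  have fwd : ∀ p ∈ nonnegCone U, ∀ q ∈ nonnegCone U, R p q → 0 < B p q := by
    intro p hp q hq hR
    have hm := nonnegCone_add hp hq
    have h1 : R p (p + q) := by
      rw [add_comm]; exact h.add_right q hq p hp p hp hR (h.irrefl hp)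
    have h2 : R (p + q) q := h.add_left p hp q hq q hq hR (h.irrefl hq)
    have ev1 := (hlim p hp).eventually (h.eventually_left p hp _ hm h1)
    have ev2 := (hlim q hq).eventually (h.eventually_right q hq _ hm h2)
    obtain ⟨e, ⟨he1, he2⟩, he⟩ := ((ev1.and ev2).and self_mem_nhdsWithin).exists
    have he : 0 < e := he
    rw [((hgrad _ (hO p hp e he)) _ hm).1] at he1
    rw [((hgrad _ (hO q hq e he)) _ hm).2] at he2
    simp only [map_add, map_smul, LinearMap.add_apply, LinearMap.smul_apply, smul_eq_mul,
      hself, hskew q p] at he1 he2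
    linarith
  refine ⟨B, hskew, fun p hp q hq => ⟨fwd p hp q hq, fun hB => ?_⟩⟩
  by_contra hn
  have hm := nonnegCone_add hp hq
  have h1 : ¬ R p (p + q) := h.not_add_right p hp q hq p hp (h.irrefl hp) hn
  have h2 : ¬ R (p + q) q := h.not_add_left p hp q hq q hq hn (h.irrefl hq)
  obtain ⟨e, he, he1, he2⟩ : ∃ e : ℝ, 0 < e ∧ 0 < B p q + e * B o (p + q) ∧
      -B p q + e * B o (p + q) < 0 := by
    refine ⟨B p q / (2 * (|B o (p + q)| + 1)), by positivity, ?_⟩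
    have hb : |B p q / (2 * (|B o (p + q)| + 1)) * B o (p + q)| ≤ B p q / 2 := by
      rw [abs_mul, abs_of_pos (by positivity), div_mul_eq_mul_div,
        div_le_div_iff₀ (by positivity) two_pos]
      nlinarith [abs_nonneg (B o (p + q))]
    have := abs_le.1 hb
    constructor <;> linarith [this.1, this.2]
  have heo := posCone_smul hoO he
  have r1 : R (p + e • o) (p + q) := by
    rw [((hgrad _ (hO p hp e he)) _ hm).1]
    simp only [map_add, map_smul, LinearMap.add_apply, LinearMap.smul_apply, smul_eq_mul,
      hself] at he1 ⊢
    linarith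
  have r2 : R (p + q) (q + e • o) := by
    rw [((hgrad _ (hO q hq e he)) _ hm).2]
    simp only [map_add, map_smul, LinearMap.add_apply, LinearMap.smul_apply, smul_eq_mul,
      hself, hskew q p] at he2 ⊢
    linarith
  -- As `p` is not above `p + q` and `p + q` is not above `q`, the strict comparisons `r1` and `r2`
  -- must be due to `e • o`, which would lie both above and below `p + q`.
  have s1 : R (e • o) (p + q) := by_contra fun hh =>
    h.not_add_left p hp _ (posCone_subset heo) _ hm h1 hh r1
  have s2 : R (p + q) (e • o) := by_contra fun hh =>
    h.not_add_right q hq _ (posCone_subset heo) _ hm h2 hh r2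
  exact h.asymm _ (posCone_subset heo) _ hm s1 s2

end SkewRepresentation

theorem PrefRel.exists_skew {U : Type*} [Fintype U] [Nonempty U] {P : PrefRel U}
    (hP : P ∈ ccsPrefs U) :
    ∃ B : (U → ℝ) →ₗ[ℝ] (U → ℝ) →ₗ[ℝ] ℝ, (∀ x y, B x y = -B y x) ∧
      ∀ p q : Lottery U, P p q ↔ 0 < B (p : U → ℝ) (q : U → ℝ) := by
  obtain ⟨B, hskew, hB⟩ := (PrefRel.isCCSOn_onVectors hP).isConeRel.exists_skew
  refine ⟨B, hskew, fun p q => ?_⟩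
  rw [← hB p (stdSimplex_subset_nonnegCone p.2) q (stdSimplex_subset_nonnegCone q.2)]
  have e1 : normalizeSum (p : U → ℝ) = p := normalizeSum_of_mem p.2
  have e2 : normalizeSum (q : U → ℝ) = q := normalizeSum_of_mem q.2
  rw [e1, e2]
  exact (P.onVectors_iff p.2 q.2).symm

/-! ### Matrices determined by their signs -/

section SignedFamily

variable {U : Type*} [DecidableEq U]

/-- A family of skew-symmetric matrices that is closed under renaming and negation, in which the
signs of the entries on a set determine the entries on that set up to scaling, and in which an
alternative can be added at the bottom of any three. -/
structure IsSignDetermined (M : Set (U → U → ℝ)) : Prop where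
  skew : ∀ m ∈ M, ∀ a b, m a b = -m b a
  perm_mem : ∀ m ∈ M, ∀ π : Equiv.Perm U, (fun a b => m (π a) (π b)) ∈ M
  neg_mem : ∀ m ∈ M, (fun a b => -m a b) ∈ M
  proportional : ∀ m ∈ M, ∀ m' ∈ M, ∀ X : Finset U,
    (∀ a ∈ X, ∀ b ∈ X, 0 < m a b ↔ 0 < m' a b) →
    ∀ x ∈ X, ∀ z ∈ X, ∀ y ∈ X, ∀ w ∈ X,
      (m' x y + m' z y) * (m x w + m z w) = (m' x w + m' z w) * (m x y + m z y)
  bottom : ∀ m ∈ M, ∀ x y z : U, ∃ m' ∈ M, ∃ w,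
    (∀ a ∈ ({x, y, z} : Finset U), ∀ b ∈ ({x, y, z} : Finset U), 0 < m a b ↔ 0 < m' a b) ∧
    ∀ a ∈ ({x, y, z} : Finset U), 0 < m' a w

namespace IsSignDetermined

variable {M : Set (U → U → ℝ)} (hM : IsSignDetermined M) {m : U → U → ℝ} (hm : m ∈ M)

include hM

theorem proportional_row {m' : U → U → ℝ} (hm : m ∈ M) (hm' : m' ∈ M) {X : Finset U}
    (h : ∀ a ∈ X, ∀ b ∈ X, 0 < m a b ↔ 0 < m' a b) {x y z : U} (hx : x ∈ X) (hy : y ∈ X)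
    (hz : z ∈ X) : m' x y * m x z = m' x z * m x y := by
  have := hM.proportional m hm m' hm' X h x hx x hx y hy z hz
  linarith

include hm

theorem diag (a : U) : m a a = 0 := by
  have := hM.skew m hm a a; linarith

theorem ne_of_pos {a b : U} (h : 0 < m a b) : a ≠ b := by
  rintro rfl
  rw [hM.diag hm] at h
  exact lt_irrefl _ h

/-- Swapping `x` and `z` and then negating preserves all signs on the chain but exchanges the two
entries of row `y` up to sign. Proportionality equates their squares. -/
theorem chain_eq {x y z : U} (h1 : 0 < m x y) (h2 : 0 < m y z) : m x y = m y z := by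
  have hxy := hM.ne_of_pos hm h1
  have hyz := hM.ne_of_pos hm h2
  have hxz : x ≠ z := by
    rintro rfl
    rw [hM.skew m hm] at h2
    linarith
  have sx : Equiv.swap x z x = z := Equiv.swap_apply_left x z
  have sz : Equiv.swap x z z = x := Equiv.swap_apply_right x z
  have sy : Equiv.swap x z y = y := Equiv.swap_apply_of_ne_of_ne hxy.symm hyz
  have s1 := hM.skew m hm x y
  have s2 := hM.skew m hm y z
  have s3 := hM.skew m hm x z
  have d := hM.diag hm
  have := hM.proportional_row hm
    (hM.neg_mem _ (hM.perm_mem m hm (Equiv.swap x z))) (X := {x, y, z}) (by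
      intro a ha b hb
      simp only [Finset.mem_insert, Finset.mem_singleton] at ha hb
      rcases ha with rfl | rfl | rfl <;> rcases hb with rfl | rfl | rfl <;>
        simp only [sx, sy, sz, d, neg_zero] <;> constructor <;> intro h <;> linarith)
    (x := y) (y := x) (z := z) (by simp) (by simp) (by simp)
  simp only [sx, sy, sz] at this
  have h3 : m x y ^ 2 = m y z ^ 2 := by rw [s1]; linarith
  exact (pow_left_inj₀ h1.le h2.le two_ne_zero).1 h3

/-- With an alternative `w` added at the bottom, both entries start chains whose second entry is `m'
y w`. Proportionality of row `y` carries their equality back to `m`. -/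
theorem column_eq {x y z : U} (h1 : 0 < m x y) (h2 : 0 < m z y) : m x y = m z y := by
  obtain ⟨m', hm', w, hag, hw⟩ := hM.bottom m hm x z y
  have e1 : 0 < m' x y := (hag x (by simp) y (by simp)).1 h1
  have e2 : 0 < m' z y := (hag z (by simp) y (by simp)).1 h2
  have e4 : m' x y = m' z y :=
    (hM.chain_eq hm' e1 (hw y (by simp))).trans (hM.chain_eq hm' e2 (hw y (by simp))).symm
  have := hM.proportional_row hm hm' hag (x := y) (y := x) (z := z) (by simp) (by simp) (by simp)
  rw [hM.skew m' hm' y x, hM.skew m' hm' y z, e4, hM.skew m hm y z, hM.skew m hm y x] at this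
  have h5 := mul_left_cancel₀ (neg_ne_zero.2 e2.ne') this
  linarith

theorem abs_eq_of_adjacent {x y z : U} (h1 : m x y ≠ 0) (h2 : m y z ≠ 0) :
    |m x y| = |m y z| := by
  have s1 := hM.skew m hm x y
  have s2 := hM.skew m hm y z
  rcases lt_or_gt_of_ne h1 with h1 | h1 <;> rcases lt_or_gt_of_ne h2 with h2 | h2
  · have := hM.chain_eq hm (x := z) (y := y) (z := x) (by linarith) (by linarith)
    rw [abs_of_neg h1, abs_of_neg h2]; linarith
  · have := hM.column_eq (hM.neg_mem m hm) (x := x) (y := y) (z := z) (by linarith) (by linarith)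
    rw [abs_of_neg h1, abs_of_pos h2]; linarith
  · have := hM.column_eq hm (x := x) (y := y) (z := z) (by linarith) (by linarith)
    rw [abs_of_pos h1, abs_of_neg h2]; linarith
  · rw [hM.chain_eq hm h1 h2]

/-- Exchanging the two pairs preserves the signs. Each single row has only one nonzero entry here,
so its proportionality says nothing; the sum of rows `x` and `z` is needed. -/
theorem eq_of_disjoint {x y z w : U} (h1 : 0 < m x y) (h2 : 0 < m z w) (hxz : m x z = 0)
    (hxw : m x w = 0) (hyz : m y z = 0) (hyw : m y w = 0) : m x y = m z w := by
  have nxy := hM.ne_of_pos hm h1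
  have nzw := hM.ne_of_pos hm h2
  have s1 := hM.skew m hm x y
  have s2 := hM.skew m hm z w
  have s3 := hM.skew m hm x z
  have s4 := hM.skew m hm x w
  have s5 := hM.skew m hm y z
  have s6 := hM.skew m hm y w
  have d := hM.diag hm
  have nxz : x ≠ z := by rintro rfl; linarith
  have nxw : x ≠ w := by rintro rfl; linarith
  have nyz : y ≠ z := by rintro rfl; linarith
  have nyw : y ≠ w := by rintro rfl; linarith
  set π : Equiv.Perm U := Equiv.swap x z * Equiv.swap y w with hπ
  have sx : π x = z := by
    rw [hπ, Equiv.Perm.mul_apply, Equiv.swap_apply_of_ne_of_ne nxy nxw, Equiv.swap_apply_left]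
  have sz : π z = x := by
    rw [hπ, Equiv.Perm.mul_apply, Equiv.swap_apply_of_ne_of_ne nyz.symm nzw,
      Equiv.swap_apply_right]
  have sy : π y = w := by
    rw [hπ, Equiv.Perm.mul_apply, Equiv.swap_apply_left,
      Equiv.swap_apply_of_ne_of_ne nxw.symm nzw.symm]
  have sw : π w = y := by
    rw [hπ, Equiv.Perm.mul_apply, Equiv.swap_apply_right,
      Equiv.swap_apply_of_ne_of_ne nxy.symm nyz]
  have := hM.proportional m hm _ (hM.perm_mem m hm π) {x, y, z, w} (by
      intro a ha b hb
      simp only [Finset.mem_insert, Finset.mem_singleton] at ha hb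
      rcases ha with rfl | rfl | rfl | rfl <;> rcases hb with rfl | rfl | rfl | rfl <;>
        simp only [sx, sy, sz, sw, d] <;> constructor <;> intro h <;> linarith)
    x (by simp) z (by simp) y (by simp) w (by simp)
  simp only [sx, sy, sz, sw, hxw] at this
  have h3 : m x y ^ 2 = m z w ^ 2 := by
    have e1 : m z y = 0 := by linarith
    rw [e1] at this
    linarith
  exact (pow_left_inj₀ h1.le h2.le two_ne_zero).1 h3

/-- All nonzero entries have the same absolute value. -/
theorem abs_eq {x y z w : U} (h1 : m x y ≠ 0) (h2 : m z w ≠ 0) : |m x y| = |m z w| := by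
  have sk := hM.skew m hm
  have nz : ∀ a b, m a b ≠ 0 → m b a ≠ 0 := fun a b h => by
    rw [sk b a]; exact neg_ne_zero.2 h
  have ab : ∀ a b, |m a b| = |m b a| := fun a b => by rw [sk a b, abs_neg]
  have adj : ∀ a b c, m a b ≠ 0 → m b c ≠ 0 → |m a b| = |m b c| := fun a b c ha hb =>
    hM.abs_eq_of_adjacent hm ha hb
  -- A nonzero entry between the pairs links them through adjacent entries; without one,
  -- `eq_of_disjoint` applies after orienting both pairs.
  by_cases hxz : m x z = 0
  swap
  · rw [ab x y, adj y x z (nz _ _ h1) hxz, adj x z w hxz h2]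
  by_cases hxw : m x w = 0
  swap
  · rw [ab x y, adj y x w (nz _ _ h1) hxw, adj x w z hxw (nz _ _ h2), ab]
  by_cases hyz : m y z = 0
  swap
  · rw [adj x y z h1 hyz, adj y z w hyz h2]
  by_cases hyw : m y w = 0
  swap
  · rw [adj x y w h1 hyw, adj y w z hyw (nz _ _ h2), ab]
  rcases lt_or_gt_of_ne h1 with h1 | h1 <;> rcases lt_or_gt_of_ne h2 with h2 | h2
  · rw [ab x y, ab z w, hM.eq_of_disjoint hm (x := y) (y := x) (z := w) (w := z)
      (by linarith [sk x y]) (by linarith [sk z w]) hyw hyz hxw hxz]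
  · rw [ab x y, hM.eq_of_disjoint hm (x := y) (y := x) (z := z) (w := w)
      (by linarith [sk x y]) h2 hyz hyw hxz hxw]
  · rw [ab z w, hM.eq_of_disjoint hm (x := x) (y := y) (z := w) (w := z)
      h1 (by linarith [sk z w]) hxw hxz hyw hyz]
  · rw [hM.eq_of_disjoint hm h1 h2 hxz hxw hyz hyw]

end IsSignDetermined

end SignedFamily

/-! ### Skew forms and their zeros -/

section SkewForm

variable {U : Type*} [Fintype U]

/-- The skew-symmetric bilinear form `B` represents `P`. -/
structure IsSkewForm (P : PrefRel U) (B : (U → ℝ) →ₗ[ℝ] (U → ℝ) →ₗ[ℝ] ℝ) : Prop where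
  skew : ∀ x y, B x y = -B y x
  pos_iff : ∀ p q : Lottery U, P p q ↔ 0 < B (p : U → ℝ) (q : U → ℝ)

theorem IsSkewForm.indiff_iff {P : PrefRel U} {B : (U → ℝ) →ₗ[ℝ] (U → ℝ) →ₗ[ℝ] ℝ}
    (h : IsSkewForm P B) (p q : Lottery U) :
    (¬ P p q ∧ ¬ P q p) ↔ B (p : U → ℝ) (q : U → ℝ) = 0 := by
  rw [h.pos_iff, h.pos_iff, h.skew (q : U → ℝ) (p : U → ℝ), neg_pos, not_lt, not_lt]
  exact ⟨fun h => le_antisymm h.1 h.2, fun h => ⟨h.le, h.ge⟩⟩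

variable [DecidableEq U]

theorem IsSkewForm.pure_iff {P : PrefRel U} {B : (U → ℝ) →ₗ[ℝ] (U → ℝ) →ₗ[ℝ] ℝ}
    (h : IsSkewForm P B) (a b : U) :
    P (Lottery.pure a) (Lottery.pure b) ↔ 0 < B (Pi.single a 1) (Pi.single b 1) :=
  h.pos_iff _ _

theorem LinearMap.apply_eq_sum_single (f : (U → ℝ) →ₗ[ℝ] ℝ) (x : U → ℝ) :
    f x = ∑ a, x a * f (Pi.single a 1) := by
  rw [LinearMap.pi_apply_eq_sum_univ f x]
  refine Finset.sum_congr rfl fun a _ => ?_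
  rw [smul_eq_mul]
  congr 2
  ext b
  simp [Pi.single_apply, eq_comm]

theorem bilinear_eq_sum_single (B : (U → ℝ) →ₗ[ℝ] (U → ℝ) →ₗ[ℝ] ℝ) (x y : U → ℝ) :
    B x y = ∑ a, ∑ b, x a * (y b * B (Pi.single a 1) (Pi.single b 1)) := by
  have := LinearMap.apply_eq_sum_single (B.flip y) x
  rw [LinearMap.flip_apply] at this
  rw [this]
  refine Finset.sum_congr rfl fun a _ => ?_
  rw [LinearMap.flip_apply, LinearMap.apply_eq_sum_single (B (Pi.single a 1)) y, Finset.mul_sum]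

theorem bilinear_eq_zero_of_support {B : (U → ℝ) →ₗ[ℝ] (U → ℝ) →ₗ[ℝ] ℝ} {X : Set U}
    (hB : ∀ a ∈ X, ∀ b ∈ X, B (Pi.single a 1) (Pi.single b 1) = 0) {x y : U → ℝ}
    (hx : ∀ a, a ∉ X → x a = 0) (hy : ∀ a, a ∉ X → y a = 0) : B x y = 0 := by
  rw [bilinear_eq_sum_single]
  refine Finset.sum_eq_zero fun a _ => Finset.sum_eq_zero fun b _ => ?_
  by_cases ha : a ∈ X
  · by_cases hb : b ∈ X
    · rw [hB a ha b hb, mul_zero, mul_zero]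
    · rw [hy b hb, zero_mul, mul_zero]
  · rw [hx a ha, zero_mul]

theorem IsSkewForm.apply_pair {P : PrefRel U} {B : (U → ℝ) →ₗ[ℝ] (U → ℝ) →ₗ[ℝ] ℝ}
    (h : IsSkewForm P B) {x y : U} (hxy : x ≠ y) {p q : Lottery U}
    (hp : p ∈ Lottery.supportedOn {x, y}) (hq : q ∈ Lottery.supportedOn {x, y}) :
    B (p : U → ℝ) (q : U → ℝ) =
      (p x * q y - p y * q x) * B (Pi.single x 1) (Pi.single y 1) := by
  have decomp : ∀ p ∈ Lottery.supportedOn ({x, y} : Set U),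
      (p : U → ℝ) = p x • Pi.single x 1 + p y • Pi.single y 1 := by
    intro p hp
    funext a
    by_cases hax : a = x
    · subst hax; simp [hxy]
    by_cases hay : a = y
    · subst hay; simp [hax]
    · rw [hp a (by simp [hax, hay])]; simp [hax, hay]
  have hself : ∀ z, B z z = 0 := fun z => by have := h.skew z z; linarith
  rw [decomp p hp, decomp q hq]
  simp only [map_add, map_smul, LinearMap.add_apply, LinearMap.smul_apply, smul_eq_mul, hself]
  rw [h.skew (Pi.single y 1) (Pi.single x 1)]
  simp [hxy, hxy.symm]
  ring

/-- On outcomes supported on two alternatives the relation is determined by the two pure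
outcomes. -/
theorem IsSkewForm.agreeOn_pair {P P' : PrefRel U} {B B' : (U → ℝ) →ₗ[ℝ] (U → ℝ) →ₗ[ℝ] ℝ}
    (h : IsSkewForm P B) (h' : IsSkewForm P' B') {x y : U} (hxy : x ≠ y)
    (h1 : P (Lottery.pure x) (Lottery.pure y) ↔ P' (Lottery.pure x) (Lottery.pure y))
    (h2 : P (Lottery.pure y) (Lottery.pure x) ↔ P' (Lottery.pure y) (Lottery.pure x)) :
    P.AgreeOn (Lottery.supportedOn {x, y}) P' := by
  intro p hp q hq
  rw [h.pos_iff, h'.pos_iff, h.apply_pair hxy hp hq, h'.apply_pair hxy hp hq]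
  rw [h.pure_iff, h'.pure_iff] at h1 h2
  rw [h.skew, h'.skew, neg_pos, neg_pos] at h2
  rcases lt_trichotomy (B (Pi.single x 1) (Pi.single y 1)) 0 with hs | hs | hs
  · have hs' := h2.1 hs
    constructor <;> intro hh
    · have := neg_of_mul_pos_left hh hs.le; exact mul_pos_of_neg_of_neg this hs'
    · have := neg_of_mul_pos_left hh hs'.le; exact mul_pos_of_neg_of_neg this hs
  · have hs' : B' (Pi.single x 1) (Pi.single y 1) = 0 := le_antisymm
      (not_lt.1 fun hh => (h1.2 hh).ne' hs) (not_lt.1 fun hh => (h2.2 hh).ne hs)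
    rw [hs, hs', mul_zero]
  · have hs' := h1.1 hs
    rw [mul_pos_iff_of_pos_right hs, mul_pos_iff_of_pos_right hs']

theorem single_add_mem_nonnegCone {x z : U} :
    (Pi.single x 1 + Pi.single z 1 : U → ℝ) ∈ nonnegCone U :=
  nonnegCone_add (stdSimplex_subset_nonnegCone (single_mem_stdSimplex ℝ x))
    (stdSimplex_subset_nonnegCone (single_mem_stdSimplex ℝ z))

omit [DecidableEq U] in
/-- If the zeros of `A` on the outcomes supported on `X` are zeros of `B`, then the rows of `A` and
`B` at nonnegative vectors are proportional on `X`. -/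
theorem bilinear_proportional_of_zeros {A B : (U → ℝ) →ₗ[ℝ] (U → ℝ) →ₗ[ℝ] ℝ} {X : Set U}
    (hA : ∀ x, A x x = 0) (hB : ∀ x, B x x = 0)
    (h : ∀ p ∈ Lottery.supportedOn X, ∀ q ∈ Lottery.supportedOn X,
      A (p : U → ℝ) (q : U → ℝ) = 0 → B (p : U → ℝ) (q : U → ℝ) = 0)
    {x u v : U → ℝ} (hx : ∀ a, 0 ≤ x a) (hxX : ∀ a, a ∉ X → x a = 0)
    (hu : ∀ a, a ∉ X → u a = 0) (hv : ∀ a, a ∉ X → v a = 0) :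
    B x u * A x v = B x v * A x u := by
  classical
  have cone : ∀ y ∈ nonnegCone U, ∀ z ∈ nonnegCone U, (∀ a, a ∉ X → y a = 0) →
      (∀ a, a ∉ X → z a = 0) → A y z = 0 → B y z = 0 := by
    intro y hy z hz hyX hzX h0
    have key := h ⟨normalizeSum y, normalizeSum_mem hy⟩
      (fun a ha => by
        change (∑ a, y a)⁻¹ * y a = 0
        rw [hyX a ha, mul_zero])
      ⟨normalizeSum z, normalizeSum_mem hz⟩
      (fun a ha => by
        change (∑ a, z a)⁻¹ * z a = 0
        rw [hzX a ha, mul_zero])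
    change A (normalizeSum y) (normalizeSum z) = 0 → B (normalizeSum y) (normalizeSum z) = 0 at key
    simp only [normalizeSum, map_smul, LinearMap.smul_apply, smul_eq_mul, h0, mul_zero,
      true_implies] at key
    have h1 : (∑ a, y a)⁻¹ ≠ 0 := inv_ne_zero hy.2.ne'
    have h2 : (∑ a, z a)⁻¹ ≠ 0 := inv_ne_zero hz.2.ne'
    simpa [h1, h2] using key
  -- Adding a large multiple of `y` makes `w` nonnegative and changes neither `A y w` nor `B y w`,
  -- as both forms vanish on the diagonal. The inclusion of zeros thus extends to signed `w`.
  have pos : ∀ y : U → ℝ, (∀ a, a ∉ X → y a = 0) → (∀ a ∈ X, 0 < y a) →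
      ∀ w : U → ℝ, (∀ a, a ∉ X → w a = 0) → A y w = 0 → B y w = 0 := by
    intro y hyX hy w hw h0
    by_cases hne : ∃ a, a ∈ X
    swap
    · push Not at hne
      have : w = 0 := funext fun a => hw a (hne a)
      rw [this, map_zero]
    obtain ⟨a₀, ha₀⟩ := hne
    have hynn : ∀ a, 0 ≤ y a := fun a => by
      by_cases ha : a ∈ X
      · exact (hy a ha).le
      · rw [hyX a ha]
    have hyC : y ∈ nonnegCone U :=
      ⟨hynn, Finset.sum_pos' (fun a _ => hynn a) ⟨a₀, Finset.mem_univ _, hy a₀ ha₀⟩⟩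
    set K : ℝ := ∑ a, |w a| / y a + 1 with hK
    have hKa : ∀ a ∈ X, 0 < w a + K * y a := by
      intro a ha
      have h1 : |w a| / y a ≤ ∑ a, |w a| / y a :=
        Finset.single_le_sum (f := fun a => |w a| / y a)
          (fun b _ => div_nonneg (abs_nonneg _) (hynn b)) (Finset.mem_univ a)
      have h2 : |w a| = |w a| / y a * y a := (div_mul_cancel₀ _ (hy a ha).ne').symm
      have h3 := neg_abs_le (w a)
      have h4 := mul_le_mul_of_nonneg_right h1 (hynn a)
      have h5 := hy a ha
      rw [hK, add_mul, one_mul]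
      linarith
    have hz0 : ∀ a, a ∉ X → (w + K • y) a = 0 := fun a ha => by
      simp [hw a ha, hyX a ha]
    have hznn : ∀ a, 0 ≤ (w + K • y) a := fun a => by
      by_cases ha : a ∈ X
      · exact (hKa a ha).le
      · rw [hz0 a ha]
    have := cone y hyC (w + K • y)
      ⟨hznn, Finset.sum_pos' (fun a _ => hznn a) ⟨a₀, Finset.mem_univ _, hKa a₀ ha₀⟩⟩
      hyX hz0 (by rw [map_add, map_smul, h0, hA, smul_zero, add_zero])
    rwa [map_add, map_smul, hB, smul_zero, add_zero] at this
  set o : U → ℝ := fun a => if a ∈ X then 1 else 0 with ho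
  -- The combination of `u` and `v` on which the row of `A` vanishes is also a zero of the row of
  -- `B`. Letting `e` tend to 0 admits `x` with zeros in `X`.
  have shifted : ∀ e : ℝ, 0 < e →
      B (x + e • o) u * A (x + e • o) v - B (x + e • o) v * A (x + e • o) u = 0 := by
    intro e he
    have := pos (x + e • o) (fun a ha => by simp [ho, ha, hxX a ha])
      (fun a ha => by simp only [ho, Pi.add_apply, Pi.smul_apply, if_pos ha, smul_eq_mul]
                      linarith [hx a])
      (A (x + e • o) v • u - A (x + e • o) u • v) (fun a ha => by simp [hu a ha, hv a ha])
      (by rw [map_sub, map_smul, map_smul, smul_eq_mul, smul_eq_mul]; ring)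
    rw [map_sub, map_smul, map_smul, smul_eq_mul, smul_eq_mul] at this
    linarith
  have hc : Continuous fun e : ℝ =>
      B (x + e • o) u * A (x + e • o) v - B (x + e • o) v * A (x + e • o) u := by
    simp only [map_add, map_smul, LinearMap.add_apply, LinearMap.smul_apply, smul_eq_mul]
    fun_prop
  have hl := (hc.tendsto 0).mono_left (nhdsWithin_le_nhds (s := Set.Ioi (0 : ℝ)))
  have h0 := tendsto_nhds_unique hl (tendsto_const_nhds.congr' (by
    filter_upwards [self_mem_nhdsWithin] with e he
    exact (shifted e he).symm))
  rw [zero_smul, add_zero] at h0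
  linarith

end SkewForm

/-! ### Profiles with two concerned agents -/

section TwoAgents

variable {U : Type*} [Fintype U] {n : ℕ} {D : Set (PrefRel U)}

/-- The profile in which `i` and `j` have the given relations and all other agents are completely
indifferent. -/
def twoAgentProfile (h0 : PrefRel.empty ∈ D) (i j : Fin n) (P Q : D) : Fin n → D :=
  fun k => if k = i then P else if k = j then Q else ⟨PrefRel.empty, h0⟩

variable (h0 : PrefRel.empty ∈ D) {i j : Fin n} (hij : i ≠ j)

include hij in
theorem twoAgentProfile_comp_swap (P Q : D) :
    twoAgentProfile h0 i j P Q ∘ Equiv.swap i j = twoAgentProfile h0 i j Q P := by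
  funext k
  simp only [twoAgentProfile, Function.comp_apply]
  by_cases hi : k = i
  · subst hi; simp [hij.symm]
  by_cases hj : k = j
  · subst hj; simp [hi]
  · rw [Equiv.swap_apply_of_ne_of_ne hi hj]; simp [hi, hj]

theorem twoAgentProfile_forall {C : PrefRel U → Prop} {P Q : D} (hP : C P) (hQ : C Q)
    (hE : C PrefRel.empty) (k : Fin n) : C (twoAgentProfile h0 i j P Q k) := by
  unfold twoAgentProfile
  split_ifs
  exacts [hP, hQ, hE]

theorem PrefRel.weak_iff_of_isAsymm {P : PrefRel U} (h : P.IsAsymm) (p q : Lottery U) :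
    P.Weak p q ↔ ¬ P q p := by
  have := h p q
  unfold PrefRel.Weak PrefRel.Indiff
  tauto

theorem PrefRel.weak_of_not {P : PrefRel U} {p q : Lottery U} (h : ¬ P q p) : P.Weak p q := by
  unfold PrefRel.Weak PrefRel.Indiff
  tauto

variable {f : SWF n D}

theorem SWF.ParetoOptimal.not_of_not (hf : f.ParetoOptimal) {P Q : D} {p q : Lottery U}
    (hP : ¬ (P : PrefRel U) q p) (hQ : ¬ (Q : PrefRel U) q p) :
    ¬ (f (twoAgentProfile h0 i j P Q) : PrefRel U) q p :=
  (PrefRel.weak_iff_of_isAsymm (f _).2.1 p q).1 (hf _ p q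
    (twoAgentProfile_forall (C := fun T => T.Weak p q) h0 (PrefRel.weak_of_not hP)
      (PrefRel.weak_of_not hQ) (PrefRel.weak_of_not id))).1

include hij in
theorem SWF.ParetoOptimal.right_of_not (hf : f.ParetoOptimal) {P Q : D} {p q : Lottery U}
    (hP : ¬ (P : PrefRel U) q p) (hQ' : ¬ (Q : PrefRel U) q p) (hQ : (Q : PrefRel U) p q) :
    (f (twoAgentProfile h0 i j P Q) : PrefRel U) p q :=
  (hf _ p q (twoAgentProfile_forall (C := fun T => T.Weak p q) h0 (PrefRel.weak_of_not hP)
    (PrefRel.weak_of_not hQ') (PrefRel.weak_of_not id))).2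
    ⟨j, by simpa [twoAgentProfile, hij.symm] using hQ⟩

theorem SWF.IIA.twoAgentProfile (hf : f.IIA) {P Q P' Q' : D} {X : Set U}
    (hP : PrefRel.AgreeOn (Lottery.supportedOn X) (P : PrefRel U) (P' : PrefRel U))
    (hQ : PrefRel.AgreeOn (Lottery.supportedOn X) (Q : PrefRel U) (Q' : PrefRel U)) :
    PrefRel.AgreeOn (Lottery.supportedOn X) (f (twoAgentProfile h0 i j P Q) : PrefRel U)
      (f (twoAgentProfile h0 i j P' Q') : PrefRel U) := by
  refine hf _ _ X fun k => ?_
  unfold _root_.twoAgentProfile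
  split_ifs
  exacts [hP, hQ, fun _ _ _ _ => Iff.rfl]

include hij in
theorem SWF.Anonymous.twoAgentProfile_comm (hf : f.Anonymous) (P Q : D) :
    f (_root_.twoAgentProfile h0 i j P Q) = f (_root_.twoAgentProfile h0 i j Q P) := by
  rw [hf _ (Equiv.swap i j), twoAgentProfile_comp_swap h0 hij]

end TwoAgents

/-! ### Consequences of richness -/

section RichDomain

variable {U : Type*} [Fintype U] [DecidableEq U] {D : Set (PrefRel U)}

theorem Lottery.perm_pure (π : Equiv.Perm U) (a : U) :
    Lottery.perm π (Lottery.pure a) = Lottery.pure (π a) := by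
  refine stdSimplex.ext (funext fun b => ?_)
  change (Pi.single a 1 : U → ℝ) (π.symm b) = (Pi.single (π a) 1 : U → ℝ) b
  simp [Pi.single_apply, Equiv.symm_apply_eq]

theorem Lottery.pure_mem_supportedOn {X : Set U} {a : U} (ha : a ∈ X) :
    Lottery.pure a ∈ Lottery.supportedOn X := by
  intro b hb
  change (Pi.single a 1 : U → ℝ) b = 0
  rw [Pi.single_apply, if_neg]
  rintro rfl
  exact hb ha

theorem IsRichDomain.perm_mem (hD : IsRichDomain D) {P : PrefRel U} (hP : P ∈ D)
    (π : Equiv.Perm U) : P.perm π ∈ D :=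
  (hD.neutral P (hD.subset_prefs hP)).1 hP π

theorem IsRichDomain.isAsymm (hD : IsRichDomain D) {P : PrefRel U} (hP : P ∈ D) : P.IsAsymm :=
  (hD.subset_prefs hP).1

theorem IsRichDomain.inverse_mem' (hD : IsRichDomain D) {P : PrefRel U} (hP : P ∈ D) :
    P.inverse ∈ D :=
  hD.inverse_mem P (hD.subset_prefs hP) hP

theorem IsRichDomain.exists_skewForm [Nonempty U] (hD : IsRichDomain D) {P : PrefRel U}
    (hP : P ∈ D) : ∃ B, IsSkewForm P B := by
  obtain ⟨B, h1, h2⟩ := PrefRel.exists_skew (hD.subset_prefs hP)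
  exact ⟨B, h1, h2⟩

theorem IsRichDomain.exists_bottom (hU : 4 ≤ Fintype.card U) (hD : IsRichDomain D)
    {Q : PrefRel U} (hQ : Q ∈ D) {X : Finset U} (hX : X.card ≤ 3) :
    ∃ P ∈ D, ∃ a : U, P.AgreeOn (Lottery.pure '' (X : Set U)) Q ∧
      ∀ x ∈ X, P (Lottery.pure x) (Lottery.pure a) := by
  refine hD.bottom Q hQ X (by omega) ?_
  rintro rfl
  rw [Finset.card_univ] at hX
  omega

/-- A rich domain contains all strict transitive orders of three pure outcomes. -/
theorem IsRichDomain.exists_chain (hU : 4 ≤ Fintype.card U) (hD : IsRichDomain D) {x y z : U}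
    (hxy : x ≠ y) (hxz : x ≠ z) (hyz : y ≠ z) :
    ∃ P ∈ D, P (Lottery.pure x) (Lottery.pure y) ∧ P (Lottery.pure y) (Lottery.pure z) ∧
      P (Lottery.pure x) (Lottery.pure z) := by
  have ne : ∀ P ∈ D, ∀ a b : U, P (Lottery.pure a) (Lottery.pure b) → a ≠ b := by
    rintro P hP a _ h rfl
    exact hD.isAsymm hP _ _ h h
  -- Two additions at the bottom, starting from complete indifference, produce a chain; a renaming
  -- moves it to the given alternatives.
  obtain ⟨P₁, hP₁, b, -, h₁⟩ := hD.exists_bottom hU hD.empty_mem (X := {x}) (by simp)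
  obtain ⟨P, hP, c, hag, h⟩ := hD.exists_bottom hU hP₁ (X := {x, b})
    (Finset.card_le_two.trans (by norm_num))
  have hxb : P (Lottery.pure x) (Lottery.pure b) :=
    (hag _ ⟨x, by simp, rfl⟩ _ ⟨b, by simp, rfl⟩).2 (h₁ x (by simp))
  have hxc := h x (by simp)
  have hbc := h b (by simp)
  let v : Fin 3 ↪ U := ⟨![x, b, c], by
    intro i j hij
    have e1 := ne P hP _ _ hxb
    have e2 := ne P hP _ _ hxc
    have e3 := ne P hP _ _ hbc
    fin_cases i <;> fin_cases j <;> simp_all⟩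
  let w : Fin 3 ↪ U := ⟨![x, y, z], by
    intro i j hij
    fin_cases i <;> fin_cases j <;> simp_all⟩
  have := Equiv.Perm.isMultiplyPretransitive U 3
  obtain ⟨π, hπ⟩ := MulAction.exists_smul_eq (Equiv.Perm U) v w
  have πx : π x = x := DFunLike.congr_fun hπ 0
  have πb : π b = y := DFunLike.congr_fun hπ 1
  have πc : π c = z := DFunLike.congr_fun hπ 2
  have key : ∀ a b : U, P (Lottery.pure a) (Lottery.pure b) →
      P.perm π (Lottery.pure (π a)) (Lottery.pure (π b)) := fun a b hab => by
    rw [← Lottery.perm_pure, ← Lottery.perm_pure, PrefRel.perm_iff]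
    exact hab
  refine ⟨P.perm π, hD.perm_mem hP π, ?_, ?_, ?_⟩
  · have := key _ _ hxb; rwa [πx, πb] at this
  · have := key _ _ hbc; rwa [πb, πc] at this
  · have := key _ _ hxc; rwa [πx, πc] at this

end RichDomain

/-! ### Disagreement of two agents -/

section Disagreement

variable {U : Type*} [Fintype U] [DecidableEq U] [Nonempty U] {n : ℕ} {D : Set (PrefRel U)}
  {f : SWF n D} {i j : Fin n}

/-- The comparison of two pure outcomes fixes a relation of the domain on all their mixtures, so IIA
applies with `X = {x, y}`. -/
theorem SWF.IIA.pure_iff (hD : IsRichDomain D) (hf : f.IIA) {P P' Q Q' : D} {x y : U}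
    (hxy : x ≠ y) (hP : (P : PrefRel U) (Lottery.pure x) (Lottery.pure y))
    (hP' : (P' : PrefRel U) (Lottery.pure x) (Lottery.pure y))
    (hQ : (Q : PrefRel U) (Lottery.pure y) (Lottery.pure x))
    (hQ' : (Q' : PrefRel U) (Lottery.pure y) (Lottery.pure x)) :
    ((f (_root_.twoAgentProfile hD.empty_mem i j P Q) : PrefRel U) (Lottery.pure x)
        (Lottery.pure y) ↔
      (f (_root_.twoAgentProfile hD.empty_mem i j P' Q') : PrefRel U) (Lottery.pure x)
        (Lottery.pure y)) ∧
    ((f (_root_.twoAgentProfile hD.empty_mem i j P Q) : PrefRel U) (Lottery.pure y)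
        (Lottery.pure x) ↔
      (f (_root_.twoAgentProfile hD.empty_mem i j P' Q') : PrefRel U) (Lottery.pure y)
        (Lottery.pure x)) := by
  have agree : ∀ (S T : D) (a b : U), a ≠ b → (S : PrefRel U) (Lottery.pure a) (Lottery.pure b) →
      (T : PrefRel U) (Lottery.pure a) (Lottery.pure b) →
      PrefRel.AgreeOn (Lottery.supportedOn {a, b}) (S : PrefRel U) (T : PrefRel U) := by
    intro S T a b hab hS hT
    obtain ⟨A, hA⟩ := hD.exists_skewForm S.2
    obtain ⟨B, hB⟩ := hD.exists_skewForm T.2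
    exact hA.agreeOn_pair hB hab (iff_of_true hS hT)
      (iff_of_false (hD.isAsymm S.2 _ _ hS) (hD.isAsymm T.2 _ _ hT))
  have hQQ := agree Q Q' y x hxy.symm hQ hQ'
  rw [Set.pair_comm] at hQQ
  have key := hf.twoAgentProfile hD.empty_mem (i := i) (j := j) (agree P P' x y hxy hP hP') hQQ
  have mx := Lottery.pure_mem_supportedOn (X := {x, y}) (a := x) (by simp)
  have my := Lottery.pure_mem_supportedOn (X := {x, y}) (a := y) (by simp)
  exact ⟨key _ mx _ my, key _ my _ mx⟩

/-- The social relation for a relation and its inverse is a multiple of that relation. -/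
theorem SWF.ParetoOptimal.inverse_profile (hD : IsRichDomain D) (hf : f.ParetoOptimal) {S : D}
    {x y z : U} (hxy : (S : PrefRel U) (Lottery.pure x) (Lottery.pure y))
    (hyz : (S : PrefRel U) (Lottery.pure y) (Lottery.pure z))
    (hxz : (S : PrefRel U) (Lottery.pure x) (Lottery.pure z))
    (h : (f (twoAgentProfile hD.empty_mem i j S ⟨_, hD.inverse_mem' S.2⟩) : PrefRel U)
      (Lottery.pure x) (Lottery.pure y)) :
    (f (twoAgentProfile hD.empty_mem i j S ⟨_, hD.inverse_mem' S.2⟩) : PrefRel U)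
      (Lottery.pure x) (Lottery.pure z) ∧
    (f (twoAgentProfile hD.empty_mem i j S ⟨_, hD.inverse_mem' S.2⟩) : PrefRel U)
      (Lottery.pure y) (Lottery.pure z) := by
  obtain ⟨A, hA⟩ := hD.exists_skewForm S.2
  obtain ⟨C, hC1, hC2⟩ := PrefRel.exists_skew
    (f (twoAgentProfile hD.empty_mem i j S ⟨_, hD.inverse_mem' S.2⟩)).2
  have hC : IsSkewForm _ C := ⟨hC1, hC2⟩
  -- By Pareto optimality, every indifference of `S` is a social indifference, so zeros of `A` are
  -- zeros of `C`.
  have row : ∀ a b c : U, C (Pi.single a 1) (Pi.single b 1) * A (Pi.single a 1) (Pi.single c 1) =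
      C (Pi.single a 1) (Pi.single c 1) * A (Pi.single a 1) (Pi.single b 1) := fun a b c =>
    bilinear_proportional_of_zeros (X := Set.univ)
      (fun x => by have := hA.skew x x; linarith) (fun x => by have := hC.skew x x; linarith)
      (fun p _ q _ h0 => by
        have h1 := (hA.indiff_iff p q).2 h0
        exact (hC.indiff_iff p q).1 ⟨hf.not_of_not _ h1.1 h1.2, hf.not_of_not _ h1.2 h1.1⟩)
      (single_mem_stdSimplex ℝ a).1 (by simp) (by simp) (by simp)
  rw [hA.pure_iff] at hxy hyz hxz
  rw [hC.pure_iff] at h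
  rw [hC.pure_iff, hC.pure_iff]
  have r1 := row x y z
  have r2 := row y x z
  rw [hC.skew (Pi.single y 1) (Pi.single x 1), hA.skew (Pi.single y 1) (Pi.single x 1)] at r2
  constructor
  · refine pos_of_mul_pos_left ?_ hxy.le
    rw [← r1]
    exact mul_pos h hxz
  · refine pos_of_mul_pos_left ?_ hxy.le
    have := mul_pos h hyz
    linarith

variable (hU : 4 ≤ Fintype.card U) (hD : IsRichDomain D) (hanon : f.Anonymous)
  (hpareto : f.ParetoOptimal) (hiia : f.IIA) (hij : i ≠ j)

include hU hanon hpareto hiia hij in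
-- Suppose that `i` prevails for `x` over `y`. With the chain `x`, `y`, `z` against its inverse, `i`
-- also prevails for `x` over `z` and for `y` over `z`; with the chain `x`, `z`, `y`, it then
-- prevails for `z` over `y`. Exchanging the agents in the verdict for `y` over `z` gives the
-- opposite ranking under the same preferences.
theorem SWF.not_left_of_disagreement {P Q : D} {x y : U}
    (hP : (P : PrefRel U) (Lottery.pure x) (Lottery.pure y))
    (hQ : (Q : PrefRel U) (Lottery.pure y) (Lottery.pure x)) :
    ¬ (f (twoAgentProfile hD.empty_mem i j P Q) : PrefRel U) (Lottery.pure x)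
      (Lottery.pure y) := by
  intro h
  have hxy : x ≠ y := by
    rintro rfl
    exact hD.isAsymm P.2 _ _ hP hP
  obtain ⟨z, -, hz⟩ : ∃ z ∈ Finset.univ, z ∉ ({x, y} : Finset U) :=
    Finset.exists_mem_notMem_of_card_lt_card (lt_of_le_of_lt Finset.card_le_two
      (by rw [Finset.card_univ]; omega))
  simp only [Finset.mem_insert, Finset.mem_singleton, not_or] at hz
  obtain ⟨S, hS, s1, s2, s3⟩ := hD.exists_chain hU hxy (Ne.symm hz.1) (Ne.symm hz.2)
  obtain ⟨T, hT, t1, t2, t3⟩ := hD.exists_chain hU (Ne.symm hz.1) hxy hz.2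
  set S' : D := ⟨S, hS⟩
  set T' : D := ⟨T, hT⟩
  set Si : D := ⟨_, hD.inverse_mem' hS⟩
  set Ti : D := ⟨_, hD.inverse_mem' hT⟩
  have g1 := (hiia.pure_iff hD (i := i) (j := j) (P := P) (P' := S') (Q := Q) (Q' := Si)
    hxy hP s1 hQ s1).1.1 h
  obtain ⟨g2, g3⟩ := hpareto.inverse_profile hD (S := S') s1 s2 s3 g1
  have g4 := (hiia.pure_iff hD (i := i) (j := j) (P := S') (P' := T') (Q := Si) (Q' := Ti)
    (Ne.symm hz.1) s3 t1 s3 t1).1.1 g2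
  obtain ⟨-, g5⟩ := hpareto.inverse_profile hD (S := T') t1 t2 t3 g4
  change (f (twoAgentProfile hD.empty_mem i j S' Si) : PrefRel U) _ _ at g3
  rw [hanon.twoAgentProfile_comm hD.empty_mem hij] at g3
  have g6 := (hiia.pure_iff hD (i := i) (j := j) (P := Si) (P' := T') (Q := S') (Q' := Ti)
    hz.2 s2 t2 s2 t2).2.1 g3
  exact (f _).2.1 _ _ g5 g6

include hU hanon hpareto hiia hij in
/-- Two agents with opposite preferences over two pure outcomes yield social indifference. -/
theorem SWF.indiff_of_disagreement {P Q : D} {x y : U}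
    (hP : (P : PrefRel U) (Lottery.pure x) (Lottery.pure y))
    (hQ : (Q : PrefRel U) (Lottery.pure y) (Lottery.pure x)) :
    ¬ (f (twoAgentProfile hD.empty_mem i j P Q) : PrefRel U) (Lottery.pure x) (Lottery.pure y) ∧
    ¬ (f (twoAgentProfile hD.empty_mem i j P Q) : PrefRel U) (Lottery.pure y)
      (Lottery.pure x) := by
  refine ⟨SWF.not_left_of_disagreement hU hD hanon hpareto hiia hij hP hQ, ?_⟩
  rw [hanon.twoAgentProfile_comm hD.empty_mem hij]
  exact SWF.not_left_of_disagreement hU hD hanon hpareto hiia hij hQ hP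

include hU hD hanon hpareto hiia hij in
/-- Relations of the domain that agree on the pure outcomes in `X` have the same indifferences on
the outcomes supported on `X`. -/
theorem SWF.zeros_of_agreeOn_pure {P Q : PrefRel U} (hP : P ∈ D) (hQ : Q ∈ D) {X : Set U}
    (hX : ∀ a ∈ X, ∀ b ∈ X, P (Lottery.pure a) (Lottery.pure b) ↔
      Q (Lottery.pure a) (Lottery.pure b))
    {p q : Lottery U} (hp : p ∈ Lottery.supportedOn X) (hq : q ∈ Lottery.supportedOn X)
    (h : ¬ P p q ∧ ¬ P q p) : ¬ Q p q ∧ ¬ Q q p := by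
  set P' : D := ⟨P, hP⟩
  set Qi : D := ⟨_, hD.inverse_mem' hQ⟩
  obtain ⟨C, hC1, hC2⟩ := PrefRel.exists_skew (f (twoAgentProfile hD.empty_mem i j P' Qi)).2
  have hC : IsSkewForm _ C := ⟨hC1, hC2⟩
  -- On pure outcomes in `X` the two agents either disagree strictly or are both indifferent.
  have hzero : ∀ a ∈ X, ∀ b ∈ X, C (Pi.single a 1) (Pi.single b 1) = 0 := by
    intro a ha b hb
    refine (hC.indiff_iff (Lottery.pure a) (Lottery.pure b)).1 ?_
    by_cases h1 : P (Lottery.pure a) (Lottery.pure b)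
    · exact SWF.indiff_of_disagreement hU hD hanon hpareto hiia hij (P := P') (Q := Qi) h1
        ((hX a ha b hb).1 h1)
    by_cases h2 : P (Lottery.pure b) (Lottery.pure a)
    · exact (SWF.indiff_of_disagreement hU hD hanon hpareto hiia hij (P := P') (Q := Qi) h2
        ((hX b hb a ha).1 h2)).symm
    · have h1' : ¬ Q (Lottery.pure a) (Lottery.pure b) := fun hh => h1 ((hX a ha b hb).2 hh)
      have h2' : ¬ Q (Lottery.pure b) (Lottery.pure a) := fun hh => h2 ((hX b hb a ha).2 hh)
      exact ⟨hpareto.not_of_not _ (P := P') (Q := Qi) h1 h2',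
        hpareto.not_of_not _ (P := P') (Q := Qi) h2 h1'⟩
  have hCpq := (hC.indiff_iff p q).2 (bilinear_eq_zero_of_support hzero hp hq)
  -- A strict preference of `Q` where `P` is indifferent would be decisive, in the inverse
  -- direction, by Pareto optimality.
  refine ⟨fun hpq => hCpq.2 ?_, fun hqp => hCpq.1 ?_⟩
  · exact hpareto.right_of_not _ hij (P := P') (Q := Qi) h.1 (hD.isAsymm hQ _ _ hpq) hpq
  · exact hpareto.right_of_not _ hij (P := P') (Q := Qi) h.2 (hD.isAsymm hQ _ _ hqp) hqp

/-- The matrices of the pairwise comparisons of pure outcomes for the relations in `D`. -/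
def comparisonMatrices (D : Set (PrefRel U)) : Set (U → U → ℝ) :=
  {m | ∃ P ∈ D, ∃ B, IsSkewForm P B ∧ m = fun a b => B (Pi.single a 1) (Pi.single b 1)}

include hU hD hanon hpareto hiia hij in
-- The bridge to the matrix argument. Proportionality is the only clause that involves the SWF; the
-- others come from skewness and richness.
theorem isSignDetermined_comparisonMatrices : IsSignDetermined (comparisonMatrices D) where
  skew := by
    rintro _ ⟨P, hP, B, hB, rfl⟩ a b
    exact hB.skew _ _
  perm_mem := by
    rintro _ ⟨P, hP, B, hB, rfl⟩ π
    refine ⟨P.perm π.symm, hD.perm_mem hP _, B.compl₁₂ (LinearMap.funLeft ℝ ℝ π.symm)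
      (LinearMap.funLeft ℝ ℝ π.symm), ⟨fun x y => hB.skew _ _, fun p q => hB.pos_iff _ _⟩, ?_⟩
    have e : ∀ a : U, LinearMap.funLeft ℝ ℝ π.symm (Pi.single a 1) = Pi.single (π a) 1 := by
      intro a
      ext b
      simp [LinearMap.funLeft_apply, Pi.single_apply, Equiv.symm_apply_eq]
    funext a b
    rw [LinearMap.compl₁₂_apply, e, e]
  neg_mem := by
    rintro _ ⟨P, hP, B, hB, rfl⟩
    refine ⟨P.inverse, hD.inverse_mem' hP, -B, ⟨fun x y => ?_, fun p q => ?_⟩, rfl⟩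
    · simp only [LinearMap.neg_apply]
      rw [hB.skew x y]
    · simp only [LinearMap.neg_apply]
      rw [← hB.skew]
      exact hB.pos_iff q p
  proportional := by
    rintro _ ⟨P, hP, A, hA, rfl⟩ _ ⟨Q, hQ, B, hB, rfl⟩ X hX x hx z hz y hy w hw
    have hs : ∀ a ∈ X, ∀ b, b ∉ (X : Set U) → (Pi.single a 1 : U → ℝ) b = 0 := by
      intro a ha b hb
      rw [Pi.single_apply, if_neg]
      rintro rfl
      exact hb ha
    have key := bilinear_proportional_of_zeros (A := A) (B := B) (X := (X : Set U))
      (x := Pi.single x 1 + Pi.single z 1) (u := Pi.single y 1) (v := Pi.single w 1)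
      (fun x => by have := hA.skew x x; linarith) (fun x => by have := hB.skew x x; linarith)
      (fun p hp q hq h0 => (hB.indiff_iff p q).1
        (SWF.zeros_of_agreeOn_pure hU hD hanon hpareto hiia hij hP hQ
          (fun a ha b hb => by
            rw [hA.pure_iff, hB.pure_iff]; exact hX a ha b hb)
          hp hq ((hA.indiff_iff p q).2 h0)))
      single_add_mem_nonnegCone.1
      (fun a ha => by rw [Pi.add_apply, hs x hx a ha, hs z hz a ha, add_zero])
      (hs y hy) (hs w hw)
    simpa only [map_add, LinearMap.add_apply] using key
  bottom := by
    rintro _ ⟨P, hP, A, hA, rfl⟩ x y z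
    obtain ⟨Q, hQ, w, hag, hw⟩ := hD.exists_bottom hU hP (X := {x, y, z}) Finset.card_le_three
    obtain ⟨B, hB⟩ := hD.exists_skewForm hQ
    refine ⟨_, ⟨Q, hQ, B, hB, rfl⟩, w, fun a ha b hb => ?_, fun a ha => ?_⟩
    · rw [← hA.pure_iff, ← hB.pure_iff]
      exact (hag _ ⟨a, ha, rfl⟩ _ ⟨b, hb, rfl⟩).symm
    · exact (hB.pure_iff a w).1 (hw a ha)

end Disagreement

/-! ### Normalization -/

section PairwiseComparisons

variable {U : Type*} [Fintype U] [DecidableEq U]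

omit [DecidableEq U] in
theorem IsSkewForm.isSSB {P : PrefRel U} {B : (U → ℝ) →ₗ[ℝ] (U → ℝ) →ₗ[ℝ] ℝ}
    (h : IsSkewForm P B) (c : ℝ) :
    IsSSB (fun p q : Lottery U => c * B (p : U → ℝ) (q : U → ℝ)) where
  skew p q := by rw [h.skew, mul_neg]
  linear_left t p q r := by
    change c * B ((t : ℝ) • (p : U → ℝ) + (1 - (t : ℝ)) • (q : U → ℝ)) (r : U → ℝ) = _
    simp only [map_add, map_smul, LinearMap.add_apply, LinearMap.smul_apply, smul_eq_mul]
    ring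
  linear_right t p q r := by
    change c * B (p : U → ℝ) ((t : ℝ) • (q : U → ℝ) + (1 - (t : ℝ)) • (r : U → ℝ)) = _
    simp only [map_add, map_smul, smul_eq_mul]
    ring

theorem bilinear_le_of_entries_le {B : (U → ℝ) →ₗ[ℝ] (U → ℝ) →ₗ[ℝ] ℝ} {c : ℝ}
    (h : ∀ a b, B (Pi.single a 1) (Pi.single b 1) ≤ c) (p q : Lottery U) :
    B (p : U → ℝ) (q : U → ℝ) ≤ c := by
  rw [bilinear_eq_sum_single]
  calc ∑ a, ∑ b, p a * (q b * B (Pi.single a 1) (Pi.single b 1))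
      ≤ ∑ a, ∑ b, p a * (q b * c) := Finset.sum_le_sum fun a _ => Finset.sum_le_sum fun b _ =>
        mul_le_mul_of_nonneg_left (mul_le_mul_of_nonneg_left (h a b) (q.2.1 b)) (p.2.1 a)
    _ = c := by
        have hp : ∑ a, p a = 1 := p.2.2
        have hq : ∑ a, q a = 1 := q.2.2
        simp only [← Finset.mul_sum, ← Finset.sum_mul, hp, hq, one_mul]

/-- A representing form whose nonzero entries have a common absolute value can be normalized to a
function based on pairwise comparisons. -/
theorem IsSkewForm.exists_isPCFunction {P : PrefRel U} {B : (U → ℝ) →ₗ[ℝ] (U → ℝ) →ₗ[ℝ] ℝ}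
    (h : IsSkewForm P B)
    (habs : ∀ x y z w : U, B (Pi.single x 1) (Pi.single y 1) ≠ 0 →
      B (Pi.single z 1) (Pi.single w 1) ≠ 0 →
      |B (Pi.single x 1) (Pi.single y 1)| = |B (Pi.single z 1) (Pi.single w 1)|) :
    ∃ φ : Lottery U → Lottery U → ℝ, IsPCFunction φ ∧ Represents φ P := by
  by_cases hz : ∀ a b : U, B (Pi.single a 1) (Pi.single b 1) = 0
  · have h0 : ∀ p q : Lottery U, B (p : U → ℝ) (q : U → ℝ) = 0 := fun p q =>
      bilinear_eq_zero_of_support (X := Set.univ) (fun a _ b _ => hz a b) (by simp) (by simp)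
    refine ⟨_, ⟨h.isSSB 1, Or.inl fun p q => ?_, fun a b => ?_⟩, fun p q => ?_⟩
    · change 1 * B (p : U → ℝ) (q : U → ℝ) = 0
      rw [h0, mul_zero]
    · change 1 * B (Pi.single a 1) (Pi.single b 1) ∈ ({-1, 0, 1} : Set ℝ)
      rw [hz, mul_zero]
      simp
    · rw [one_mul, h.pos_iff]
  · push Not at hz
    obtain ⟨x, y, hxy⟩ : ∃ x y : U, 0 < B (Pi.single x 1) (Pi.single y 1) := by
      obtain ⟨a, b, hab⟩ := hz
      rcases lt_or_gt_of_ne hab with hlt | hgt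
      · exact ⟨b, a, by rw [h.skew]; linarith⟩
      · exact ⟨a, b, hgt⟩
    set c := B (Pi.single x 1) (Pi.single y 1) with hc
    have entry : ∀ a b : U, B (Pi.single a 1) (Pi.single b 1) = 0 ∨
        B (Pi.single a 1) (Pi.single b 1) = c ∨ B (Pi.single a 1) (Pi.single b 1) = -c := by
      intro a b
      by_cases hab : B (Pi.single a 1) (Pi.single b 1) = 0
      · exact Or.inl hab
      · refine Or.inr (abs_eq_abs.1 ?_)
        exact habs a b x y hab hxy.ne'
    -- Values of `B` on outcomes are weighted averages of its entries, so the largest value is `c`.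
    have hle : ∀ a b : U, B (Pi.single a 1) (Pi.single b 1) ≤ c := by
      intro a b
      rcases entry a b with e | e | e <;> rw [e] <;> linarith
    refine ⟨_, ⟨h.isSSB c⁻¹, Or.inr ⟨⟨Lottery.pure x, Lottery.pure y, ?_⟩, ?_⟩, fun a b => ?_⟩,
      fun p q => ?_⟩
    · exact inv_mul_cancel₀ hxy.ne'
    · rintro _ ⟨p, q, rfl⟩
      calc c⁻¹ * B (p : U → ℝ) (q : U → ℝ) ≤ c⁻¹ * c :=
            mul_le_mul_of_nonneg_left (bilinear_le_of_entries_le hle p q) (inv_nonneg.2 hxy.le)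
        _ = 1 := inv_mul_cancel₀ hxy.ne'
    · change c⁻¹ * B (Pi.single a 1) (Pi.single b 1) ∈ ({-1, 0, 1} : Set ℝ)
      rcases entry a b with e | e | e <;> rw [e]
      · simp
      · rw [inv_mul_cancel₀ hxy.ne']; simp
      · rw [mul_neg, inv_mul_cancel₀ hxy.ne']; simp
    · rw [h.pos_iff, mul_pos_iff_of_pos_left (inv_pos.2 hxy)]

end PairwiseComparisons

theorem theorem1 {U : Type*} [Fintype U] [DecidableEq U] (hU : 4 ≤ Fintype.card U)
    {n : ℕ} (hn : 2 ≤ n) (D : Set (PrefRel U)) (hD : IsRichDomain D)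
    (f : SWF n D) (hanon : f.Anonymous) (hpareto : f.ParetoOptimal) (hiia : f.IIA) :
    D ⊆ pcPrefs U := by
  intro P hP
  have : Nonempty U := Fintype.card_pos_iff.1 (by omega)
  have hij : (⟨0, by omega⟩ : Fin n) ≠ ⟨1, by omega⟩ := by simp
  obtain ⟨B, hB⟩ := hD.exists_skewForm hP
  have hM := isSignDetermined_comparisonMatrices hU hD hanon hpareto hiia hij
  exact ⟨hD.subset_prefs hP, hB.exists_isPCFunction fun x y z w h1 h2 =>
    hM.abs_eq ⟨P, hP, B, hB, rfl⟩ h1 h2⟩
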